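/- Let $a<b<c$ be natural numbers with $\gcd(a,b,c)=1$ such that the numbers $a^pb^qc^l$ $(p,q,l\in\mathbb N_0)$ are pairwise distinct (this holds, for instance, if $a\ge 2$ and $a,b,c$ are pairwise coprime). For real $x$ let $N_{a,b,c}(x)$ be the number of triples $(p,q,l)\in\mathbb N_0^3$ with $a^pb^qc^l\le x$, and let $\chi_{S_{a,b,c}}$ be the characteristic function of $S_{a,b,c}=\{a^pb^qc^l: p,q,l\in\mathbb N_0\}$. Let $B_1^*(\{y\})=\{y\}-\frac12$ for $y\notin\mathbb Z$ and $B_1^*(\{y\})=0$ for $y\in\mathbb Z$, where $\{y\}$ is the fractional part. For distinct $u,v,w\in\{a,b,c\}$ and real $x\ge 1$, $R>0$ put $$C_{u,v}(x;R)=\sum_{1\le k\le R\log u}\frac{\cos\left(\frac{\pi k\log v}{\log u}\right)\cos\left(2\pi k\frac{\log x}{\log u}\right)}{k\,\sin\left(\frac{\pi k\log v}{\log u}\right)},$$ $$D_{u;v,w}(x;R)=\sum_{1\le k\le R\log u}\frac{\cos\left(\frac{\pi k\log v}{\log u}\right)\cos\left(\frac{\pi k\log w}{\log u}\right)\sin\left(2\pi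 k\frac{\log x}{\log u}\right)}{k\,\sin\left(\frac{\pi k\log v}{\log u}\right)\sin\left(\frac{\pi k\log w}{\log u}\right)}.$$ For $\delta>0$ let $\mathcal R_\delta$ be the set of real $R$ for which each of $R\log a$, $R\log b$, $R\log c$ has distance at least $\delta$ from every integer. Then $\mathcal R_\delta$ is unbounded above for some $\delta>0$, and for every real $x\ge1$ there are real numbers $P_{a,b}(x),P_{b,c}(x),P_{a,c}(x),Q(x)$ such that, for every $\delta>0$, as $R\to\infty$ through $\mathcal R_\delta$, $$C_{u,v}(x;R)+C_{v,u}(x;R)\to P_{u,v}(x)\quad\text{for }(u,v)\in\{(a,b),(b,c),(a,c)\},$$ $$D_{a;b,c}(x;R)+D_{b;a,c}(x;R)+D_{c;a,b}(x;R)\to Q(x),$$ and $$\begin{aligned}N_{a,b,c}(x)={}&\frac{\log(x)^3}{6\log a\log b\log c}+\frac{\log(x)^2}{4\log a\log b}+\frac{\log(x)^2}{4\log a\log c}+\frac{\log(x)^2}{4\log b\log c}+\frac{\log x}{4\log a}+\frac{\log x}{4\log b}+\frac{\log x}{4\log c}\\&+\frac{\log a\log x}{12\log b\log c}+\frac{\log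 b\log x}{12\log a\log c}+\frac{\log c\log x}{12\log a\log b}+\frac{\log a}{24\log b}+\frac{\log a}{24\log c}+\frac{\log b}{24\log a}+\frac{\log b}{24\log c}+\frac{\log c}{24\log a}+\frac{\log c}{24\log b}+\frac18\\&-\frac14B_1^*\left(\left\{\frac{\log x}{\log a}\right\}\right)-\frac14B_1^*\left(\left\{\frac{\log x}{\log b}\right\}\right)-\frac14B_1^*\left(\left\{\frac{\log x}{\log c}\right\}\right)\\&-\frac1{4\pi}P_{a,b}(x)-\frac1{4\pi}P_{b,c}(x)-\frac1{4\pi}P_{a,c}(x)-\frac1{4\pi}Q(x)+\frac12\chi_{S_{a,b,c}}(x).\end{aligned}$$ In particular, all of this holds for $(a,b,c)=(2,3,5)$, which gives the formula for $N_{2,3,5}(x)$, $x\ge1$. -/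

import Mathlib

open Filter Topology

noncomputable section

/-- `N_{a,b,c}(x)`: the number of triples `(p, q, l)` of natural numbers with
`a ^ p * b ^ q * c ^ l ≤ x`. -/
def smoothCount (a b c : ℕ) (x : ℝ) : ℕ :=
  Set.ncard {t : ℕ × ℕ × ℕ | ((a ^ t.1 * b ^ t.2.1 * c ^ t.2.2 : ℕ) : ℝ) ≤ x}

/-- `S_{a,b,c}`: the numbers of the form `a ^ p * b ^ q * c ^ l`, as a set of real numbers. -/
def smoothSet (a b c : ℕ) : Set ℝ :=
  {y | ∃ p q l : ℕ, y = ((a ^ p * b ^ q * c ^ l : ℕ) : ℝ)}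

/-- The characteristic function of `S_{a,b,c}`. -/
def smoothChar (a b c : ℕ) (x : ℝ) : ℝ :=
  (smoothSet a b c).indicator (fun _ => (1 : ℝ)) x

/-- `B₁^*({y})`: it is `{y} - 1/2` if `y` is not an integer, and `0` if `y` is an integer. -/
def bernoulliOneStar (y : ℝ) : ℝ :=
  if Int.fract y = 0 then 0 else Int.fract y - 1 / 2

/-- The part of the formula that is a cubic polynomial in `log x`. -/
def cubicPart (a b c : ℕ) (x : ℝ) : ℝ :=
  Real.log x ^ 3 / (6 * Real.log a * Real.log b * Real.log c)
    + Real.log x ^ 2 / (4 * Real.log a * Real.log b)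
    + Real.log x ^ 2 / (4 * Real.log a * Real.log c)
    + Real.log x ^ 2 / (4 * Real.log b * Real.log c)
    + Real.log x / (4 * Real.log a)
    + Real.log x / (4 * Real.log b)
    + Real.log x / (4 * Real.log c)
    + Real.log a * Real.log x / (12 * Real.log b * Real.log c)
    + Real.log b * Real.log x / (12 * Real.log a * Real.log c)
    + Real.log c * Real.log x / (12 * Real.log a * Real.log b)
    + Real.log a / (24 * Real.log b) + Real.log a / (24 * Real.log c)
    + Real.log b / (24 * Real.log a) + Real.log b / (24 * Real.log c)
    + Real.log c / (24 * Real.log a) + Real.log c / (24 * Real.log b)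
    + 1 / 8

/-- The sum over `1 ≤ k ≤ ⌊R log a⌋` of
`cot (π k log b / log a) * cos (2 π k log x / log a) / k`. -/
def cotCosSum (a b : ℕ) (x R : ℝ) : ℝ :=
  ∑ k ∈ Finset.Icc 1 ⌊R * Real.log a⌋₊,
    Real.cos (Real.pi * k * Real.log b / Real.log a)
        * Real.cos (2 * Real.pi * k * (Real.log x / Real.log a))
      / (k * Real.sin (Real.pi * k * Real.log b / Real.log a))

/-- The sum over `1 ≤ k ≤ ⌊R log a⌋` of
`cot (π k log b / log a) * cot (π k log c / log a) * sin (2 π k log x / log a) / k`. -/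
def cotCotSinSum (a b c : ℕ) (x R : ℝ) : ℝ :=
  ∑ k ∈ Finset.Icc 1 ⌊R * Real.log a⌋₊,
    Real.cos (Real.pi * k * Real.log b / Real.log a)
        * Real.cos (Real.pi * k * Real.log c / Real.log a)
        * Real.sin (2 * Real.pi * k * (Real.log x / Real.log a))
      / (k * Real.sin (Real.pi * k * Real.log b / Real.log a)
          * Real.sin (Real.pi * k * Real.log c / Real.log a))

/-- `R → ∞` through the real numbers for which each of `R log a`, `R log b`, `R log c` has
distance at least `δ` from every integer. -/
def separatedAtTop (a b c : ℕ) (δ : ℝ) : Filter ℝ :=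
  atTop ⊓ 𝓟 {R : ℝ | ∀ m : ℤ, δ ≤ |R * Real.log a - m| ∧ δ ≤ |R * Real.log b - m| ∧
    δ ≤ |R * Real.log c - m|}

end

/-! Put `u = log x` and let `α` list the logarithms of the bases. The function `e^(us) / ∏ (1 -
e^(-α_j s))` expands for `Re s > 0` as the sum of `e^((u - n·α)s)` over lattice points `n`. The
triples to be counted are those whose exponent is nonnegative. `expRemainder` subtracts these
finitely many terms, the constant ones with weight one half. What is left tends to a constant `θ` as
`Re s → ∞` and to `-θ` as `Re s → -∞`, where `θ` is half the number of constant terms.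

Integrate `expRemainder / s` over a rectangle with corners `±M ± iT`, `T = 2πR = M²`. When `R` is
separated, the horizontal sides stay away from all poles, the integrand is `O(1/T)` there, and these
sides contribute `O(M/T)`. On the vertical sides the constants `±θ` cancel because `1/s` is odd, and
the error is exponentially small. Hence the integral tends to zero.

By the residue theorem, up to the factor `2πi` the same integral is the sum of the residues at
`2πik/α_j`, plus a Taylor coefficient coming from the multiple pole at `0`, minus the half-weighted
lattice count. Irrationality of the ratios `α_i/α_j` makes the nonzero poles simple. So the residue
sums converge to the count minus the Taylor coefficient (`tendsto_residueSum`), for any number of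
bases.

Since `1/(1 - e^(-2iθ)) = (1 - i cot θ)/2`, adding the residues at `k` and `-k` gives sine,
cotangent-cosine and cotangent-cotangent-sine terms. One base yields the sawtooth series with limit
`-π B₁^*`. Two bases then give convergence of the paired cotangent-cosine sums. With three bases
every other sum is known to converge, so the remaining one converges too, and solving for the count
gives the formula. The cubic polynomial in `log x` is the coefficient of `s³` in `e^(us) ∏ s/(1 -
e^(-α_j s))`. -/

/-! ### Contour integrals over a rectangle and Cauchy's theorem. -/

/-- The integral of `f` over the boundary of the rectangle with corners `±M ± iT`. -/
noncomputable def rectIntegral (f : ℂ → ℂ) (M T : ℝ) : ℂ :=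
  (∫ x in (-M)..M, f (x + (-T : ℝ) * Complex.I)) - (∫ x in (-M)..M, f (x + T * Complex.I))
    + Complex.I * (∫ y in (-T)..T, f (M + y * Complex.I))
    - Complex.I * (∫ y in (-T)..T, f ((-M : ℝ) + y * Complex.I))

/-- The boundary of the rectangle with corners `±M ± iT`. -/
def frame (M T : ℝ) : Set ℂ :=
  {z | (|z.re| ≤ M ∧ |z.im| = T) ∨ (|z.re| = M ∧ |z.im| ≤ T)}

section frame

variable {M T : ℝ}

lemma bottom_mem_frame (hM : 0 ≤ M) (hT : 0 ≤ T) {x : ℝ} (hx : x ∈ Set.uIcc (-M) M) :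
    ((x : ℂ) + (-T : ℝ) * Complex.I) ∈ frame M T := by
  rw [Set.uIcc_of_le (by linarith)] at hx
  left
  simp [abs_le, hx.1, hx.2, abs_of_nonneg hT]

lemma top_mem_frame (hM : 0 ≤ M) (hT : 0 ≤ T) {x : ℝ} (hx : x ∈ Set.uIcc (-M) M) :
    ((x : ℂ) + T * Complex.I) ∈ frame M T := by
  rw [Set.uIcc_of_le (by linarith)] at hx
  left
  simp [abs_le, hx.1, hx.2, abs_of_nonneg hT]

lemma right_mem_frame (hM : 0 ≤ M) (hT : 0 ≤ T) {y : ℝ} (hy : y ∈ Set.uIcc (-T) T) :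
    ((M : ℂ) + y * Complex.I) ∈ frame M T := by
  rw [Set.uIcc_of_le (by linarith)] at hy
  right
  simp [abs_le, hy.1, hy.2, abs_of_nonneg hM]

lemma left_mem_frame (hM : 0 ≤ M) (hT : 0 ≤ T) {y : ℝ} (hy : y ∈ Set.uIcc (-T) T) :
    (((-M : ℝ) : ℂ) + y * Complex.I) ∈ frame M T := by
  rw [Set.uIcc_of_le (by linarith)] at hy
  right
  simp [abs_le, hy.1, hy.2, abs_of_nonneg hM]

lemma intervalIntegrable_bottom (hM : 0 ≤ M) (hT : 0 ≤ T) {f : ℂ → ℂ}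
    (hf : ContinuousOn f (frame M T)) :
    IntervalIntegrable (fun x : ℝ => f (x + (-T : ℝ) * Complex.I)) MeasureTheory.volume (-M) M :=
  (hf.comp (by fun_prop) fun _ hx => bottom_mem_frame hM hT hx).intervalIntegrable

lemma intervalIntegrable_top (hM : 0 ≤ M) (hT : 0 ≤ T) {f : ℂ → ℂ}
    (hf : ContinuousOn f (frame M T)) :
    IntervalIntegrable (fun x : ℝ => f (x + T * Complex.I)) MeasureTheory.volume (-M) M :=
  (hf.comp (by fun_prop) fun _ hx => top_mem_frame hM hT hx).intervalIntegrable

lemma intervalIntegrable_right (hM : 0 ≤ M) (hT : 0 ≤ T) {f : ℂ → ℂ}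
    (hf : ContinuousOn f (frame M T)) :
    IntervalIntegrable (fun y : ℝ => f (M + y * Complex.I)) MeasureTheory.volume (-T) T :=
  (hf.comp (by fun_prop) fun _ hx => right_mem_frame hM hT hx).intervalIntegrable

lemma intervalIntegrable_left (hM : 0 ≤ M) (hT : 0 ≤ T) {f : ℂ → ℂ}
    (hf : ContinuousOn f (frame M T)) :
    IntervalIntegrable (fun y : ℝ => f ((-M : ℝ) + y * Complex.I)) MeasureTheory.volume (-T) T :=
  (hf.comp (by fun_prop) fun _ hx => left_mem_frame hM hT hx).intervalIntegrable

lemma rectIntegral_sub (hM : 0 ≤ M) (hT : 0 ≤ T) {f g : ℂ → ℂ}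
    (hf : ContinuousOn f (frame M T)) (hg : ContinuousOn g (frame M T)) :
    rectIntegral (fun z => f z - g z) M T = rectIntegral f M T - rectIntegral g M T := by
  unfold rectIntegral
  rw [intervalIntegral.integral_sub (intervalIntegrable_bottom hM hT hf)
      (intervalIntegrable_bottom hM hT hg),
    intervalIntegral.integral_sub (intervalIntegrable_top hM hT hf)
      (intervalIntegrable_top hM hT hg),
    intervalIntegral.integral_sub (intervalIntegrable_right hM hT hf)
      (intervalIntegrable_right hM hT hg),
    intervalIntegral.integral_sub (intervalIntegrable_left hM hT hf)
      (intervalIntegrable_left hM hT hg)]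
  ring

lemma rectIntegral_sum (hM : 0 ≤ M) (hT : 0 ≤ T) {κ : Type*} (S : Finset κ) {f : κ → ℂ → ℂ}
    (hf : ∀ i ∈ S, ContinuousOn (f i) (frame M T)) :
    rectIntegral (fun z => ∑ i ∈ S, f i z) M T = ∑ i ∈ S, rectIntegral (f i) M T := by
  unfold rectIntegral
  rw [intervalIntegral.integral_finsetSum fun i hi => intervalIntegrable_bottom hM hT (hf i hi),
    intervalIntegral.integral_finsetSum fun i hi => intervalIntegrable_top hM hT (hf i hi),
    intervalIntegral.integral_finsetSum fun i hi => intervalIntegrable_right hM hT (hf i hi),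
    intervalIntegral.integral_finsetSum fun i hi => intervalIntegrable_left hM hT (hf i hi)]
  simp only [Finset.sum_add_distrib, Finset.sum_sub_distrib, Finset.mul_sum]

lemma rectIntegral_const_mul (c : ℂ) (f : ℂ → ℂ) :
    rectIntegral (fun z => c * f z) M T = c * rectIntegral f M T := by
  unfold rectIntegral
  simp only [intervalIntegral.integral_const_mul]
  ring

lemma rectIntegral_congr (hM : 0 ≤ M) (hT : 0 ≤ T) {f g : ℂ → ℂ}
    (h : Set.EqOn f g (frame M T)) : rectIntegral f M T = rectIntegral g M T := by
  unfold rectIntegral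
  rw [intervalIntegral.integral_congr fun x hx => h (bottom_mem_frame hM hT hx),
    intervalIntegral.integral_congr fun x hx => h (top_mem_frame hM hT hx),
    intervalIntegral.integral_congr fun x hx => h (right_mem_frame hM hT hx),
    intervalIntegral.integral_congr fun x hx => h (left_mem_frame hM hT hx)]

lemma integral_horizontal_eq_sub {F f : ℂ → ℂ} {a b y : ℝ}
    (hd : ∀ x ∈ Set.uIcc a b, HasDerivAt F (f (x + y * Complex.I)) (x + y * Complex.I))
    (hi : IntervalIntegrable (fun x : ℝ => f (x + y * Complex.I)) MeasureTheory.volume a b) :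
    ∫ x in a..b, f (x + y * Complex.I) = F (b + y * Complex.I) - F (a + y * Complex.I) := by
  refine intervalIntegral.integral_eq_sub_of_hasDerivAt
    (f := fun x : ℝ => F (x + y * Complex.I)) (fun x hx => ?_) hi
  have h1 : HasDerivAt (fun x : ℝ => (x : ℂ) + y * Complex.I) 1 x :=
    (Complex.ofRealCLM.hasDerivAt (x := x)).add_const _
  have h2 := (hd x hx).comp x h1
  rwa [mul_one] at h2

lemma integral_vertical_eq_sub {F f : ℂ → ℂ} {a b x : ℝ}
    (hd : ∀ y ∈ Set.uIcc a b, HasDerivAt F (f (x + y * Complex.I)) (x + y * Complex.I))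
    (hi : IntervalIntegrable (fun y : ℝ => f (x + y * Complex.I)) MeasureTheory.volume a b) :
    Complex.I * ∫ y in a..b, f (x + y * Complex.I)
      = F (x + b * Complex.I) - F (x + a * Complex.I) := by
  rw [← intervalIntegral.integral_const_mul]
  refine intervalIntegral.integral_eq_sub_of_hasDerivAt
    (f := fun y : ℝ => F (x + y * Complex.I)) (fun y hy => ?_) (hi.const_mul _)
  have h1 : HasDerivAt (fun y : ℝ => (x : ℂ) + y * Complex.I) Complex.I y := by
    simpa using ((Complex.ofRealCLM.hasDerivAt (x := y)).mul_const Complex.I).const_add (x : ℂ)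
  have h2 := (hd y hy).comp y h1
  rwa [mul_comm] at h2

lemma rectIntegral_eq_zero_of_hasDerivAt (hM : 0 ≤ M) (hT : 0 ≤ T) {F f : ℂ → ℂ}
    (hd : ∀ z ∈ frame M T, HasDerivAt F (f z) z) (hf : ContinuousOn f (frame M T)) :
    rectIntegral f M T = 0 := by
  unfold rectIntegral
  rw [integral_horizontal_eq_sub (fun x hx => hd _ (bottom_mem_frame hM hT hx))
      (intervalIntegrable_bottom hM hT hf),
    integral_horizontal_eq_sub (fun x hx => hd _ (top_mem_frame hM hT hx))
      (intervalIntegrable_top hM hT hf),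
    integral_vertical_eq_sub (fun x hx => hd _ (right_mem_frame hM hT hx))
      (intervalIntegrable_right hM hT hf),
    integral_vertical_eq_sub (fun x hx => hd _ (left_mem_frame hM hT hx))
      (intervalIntegrable_left hM hT hf)]
  ring

lemma ne_of_mem_frame {z p : ℂ} (hz : z ∈ frame M T) (hre : |p.re| < M) (him : |p.im| < T) :
    z ≠ p := by
  rintro rfl
  rcases hz with h | h
  · exact him.ne h.2
  · exact hre.ne h.1

lemma log_sub_log_neg_of_im_pos {w : ℂ} (hw : 0 < w.im) :
    Complex.log w - Complex.log (-w) = Real.pi * Complex.I := by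
  apply Complex.ext
  · simp [Complex.log_re]
  · simp [Complex.log_im, Complex.arg_neg_eq_arg_sub_pi_of_im_pos hw]

/-- The winding number of the rectangle around an interior point is one. -/
lemma rectIntegral_inv_sub {p : ℂ} (hre : |p.re| < M) (him : |p.im| < T) :
    rectIntegral (fun z => (z - p)⁻¹) M T = 2 * Real.pi * Complex.I := by
  have hM : 0 ≤ M := (abs_nonneg _).trans hre.le
  have hT : 0 ≤ T := (abs_nonneg _).trans him.le
  have hc : ContinuousOn (fun z : ℂ => (z - p)⁻¹) (frame M T) := by
    refine ContinuousOn.inv₀ (by fun_prop) fun z hz => sub_ne_zero.2 (ne_of_mem_frame hz hre him)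
  -- On the bottom, right and top sides `log (z - p)` is a primitive. The left side crosses its
  -- branch cut, so there `log (p - z)` is used. The two branches differ by `πi` in opposite
  -- directions at the two left corners, which produces `2πi`.
  have hlog : ∀ z : ℂ, z - p ∈ Complex.slitPlane →
      HasDerivAt (fun z => Complex.log (z - p)) ((z - p)⁻¹) z := fun z hz => by
    simpa using ((hasDerivAt_id z).sub_const p).clog hz
  have hlog' : ∀ z : ℂ, p - z ∈ Complex.slitPlane →
      HasDerivAt (fun z => Complex.log (p - z)) ((z - p)⁻¹) z := fun z hz => by
    have := ((hasDerivAt_id z).const_sub p).clog hz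
    rw [← neg_sub p z, inv_neg]
    simpa [neg_div] using this
  obtain ⟨hr1, hr2⟩ := abs_lt.1 hre
  obtain ⟨hi1, hi2⟩ := abs_lt.1 him
  unfold rectIntegral
  rw [integral_horizontal_eq_sub (fun x _ => hlog _ (Or.inr (by
        simp only [Complex.sub_im, Complex.add_im, Complex.ofReal_im, Complex.mul_im,
          Complex.ofReal_re, Complex.I_im, Complex.I_re]
        apply ne_of_lt; linarith)))
      (intervalIntegrable_bottom hM hT hc),
    integral_horizontal_eq_sub (fun x _ => hlog _ (Or.inr (by
        simp only [Complex.sub_im, Complex.add_im, Complex.ofReal_im, Complex.mul_im,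
          Complex.ofReal_re, Complex.I_im, Complex.I_re]
        apply ne_of_gt; linarith)))
      (intervalIntegrable_top hM hT hc),
    integral_vertical_eq_sub (fun x _ => hlog _ (Or.inl (by
        simp only [Complex.sub_re, Complex.add_re, Complex.ofReal_im, Complex.mul_re,
          Complex.ofReal_re, Complex.I_im, Complex.I_re]
        linarith)))
      (intervalIntegrable_right hM hT hc),
    integral_vertical_eq_sub (fun x _ => hlog' _ (Or.inl (by
        simp only [Complex.sub_re, Complex.add_re, Complex.ofReal_im, Complex.mul_re,
          Complex.ofReal_re, Complex.I_im, Complex.I_re]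
        linarith)))
      (intervalIntegrable_left hM hT hc)]
  have h1 := log_sub_log_neg_of_im_pos (w := ((-M : ℝ) : ℂ) + T * Complex.I - p) (by
    simp; linarith)
  have h2 := log_sub_log_neg_of_im_pos (w := p - (((-M : ℝ) : ℂ) + (-T : ℝ) * Complex.I)) (by
    simp; linarith)
  rw [neg_sub] at h1 h2
  linear_combination h1 + h2

lemma rectIntegral_zpow (hM : 0 < M) (hT : 0 < T) (m : ℤ) :
    rectIntegral (fun z => z ^ m) M T = if m = -1 then 2 * Real.pi * Complex.I else 0 := by
  have h0 : ∀ z ∈ frame M T, z ≠ 0 := fun z hz => ne_of_mem_frame hz (by simpa) (by simpa)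
  split_ifs with h
  · subst h
    simpa using rectIntegral_inv_sub (M := M) (T := T) (p := 0) (by simpa) (by simpa)
  · have hm : ((m + 1 : ℤ) : ℂ) ≠ 0 := by
      rw [Int.cast_ne_zero]; omega
    refine rectIntegral_eq_zero_of_hasDerivAt hM.le hT.le
      (F := fun z => z ^ (m + 1) / ((m + 1 : ℤ) : ℂ)) (fun z hz => ?_) ?_
    · have := (hasDerivAt_zpow (m + 1) z (Or.inl (h0 z hz))).div_const ((m + 1 : ℤ) : ℂ)
      rwa [mul_div_cancel_left₀ _ hm, add_sub_cancel_right] at this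
    · exact continuousOn_id.zpow₀ _ fun z hz => Or.inl (h0 z hz)

/-- Cauchy's theorem with finitely many removable singularities. -/
lemma rectIntegral_eq_zero_of_isBigO (hM : 0 < M) (hT : 0 < T) {g : ℂ → ℂ} (S : Set ℂ)
    (hSin : ∀ p ∈ S, |p.re| < M ∧ |p.im| < T)
    (hd : ∀ z, z ∉ S → |z.re| ≤ M → |z.im| ≤ T → AnalyticAt ℂ g z)
    (hb : ∀ p ∈ S, MeromorphicAt g p ∧ g =O[𝓝[≠] p] (fun _ => (1 : ℂ))) :
    rectIntegral g M T = 0 := by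
  -- Replacing each value by the punctured limit fills in all the removable singularities at once,
  -- so `G` is holomorphic on the closed rectangle and agrees with `g` on its boundary.
  set G : ℂ → ℂ := fun z => limUnder (𝓝[≠] z) g with hG
  have hGg : ∀ z, DifferentiableAt ℂ g z → G z = g z := fun z hz =>
    (hz.continuousAt.tendsto.mono_left nhdsWithin_le_nhds).limUnder_eq
  have hGd : ∀ z, |z.re| ≤ M → |z.im| ≤ T → DifferentiableAt ℂ G z := by
    intro z hre him
    by_cases hz : z ∈ S
    · obtain ⟨hz1, hz2⟩ := hb z hz
      obtain ⟨s, hs, hs'⟩ : ∃ s ∈ 𝓝 z, ∀ w ∈ s \ {z}, DifferentiableAt ℂ g w := by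
        exact ⟨_, eventually_nhdsWithin_iff.1 hz1.eventually_analyticAt,
          fun w hw => (hw.1 hw.2).differentiableAt⟩
      have hdiff := Complex.differentiableOn_update_limUnder_of_isLittleO hs
        (fun w hw => (hs' w hw).differentiableWithinAt)
        (by
          have h1 : (fun w => g w - g z) =O[𝓝[≠] z] (fun _ => (1 : ℂ)) :=
            hz2.sub (Asymptotics.isBigO_const_const _ one_ne_zero _)
          refine h1.trans_isLittleO ?_
          rw [Asymptotics.isLittleO_const_left]
          right
          refine (tendsto_norm_inv_nhdsNE_zero_atTop (α := ℂ)).comp ?_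
          have : Tendsto (fun w => w - z) (𝓝 z) (𝓝 (z - z)) := by
            exact (continuous_id.sub continuous_const).tendsto z
          rw [sub_self] at this
          refine tendsto_nhdsWithin_iff.2 ⟨this.mono_left nhdsWithin_le_nhds, ?_⟩
          filter_upwards [self_mem_nhdsWithin] with w hw
          exact sub_ne_zero.2 hw)
      refine (hdiff.differentiableAt hs).congr_of_eventuallyEq ?_
      filter_upwards [hs] with w hw
      by_cases hwz : w = z
      · subst hwz; simp [hG]
      · rw [Function.update_of_ne hwz, hGg w (hs' w ⟨hw, hwz⟩)]
    · exact (hd z hz hre him).differentiableAt.congr_of_eventuallyEq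
        ((hd z hz hre him).eventually_analyticAt.mono fun w hw => hGg w hw.differentiableAt)
  have key := Complex.integral_boundary_rect_eq_zero_of_differentiableOn G
    (⟨-M, -T⟩ : ℂ) (⟨M, T⟩ : ℂ) (by
      intro z hz
      rw [Complex.mem_reProdIm, Set.uIcc_of_le (by simp; linarith),
        Set.uIcc_of_le (by simp; linarith)] at hz
      exact (hGd z (abs_le.2 hz.1) (abs_le.2 hz.2)).differentiableWithinAt)
  rw [rectIntegral_congr hM.le hT.le (g := G)]
  · simpa [rectIntegral] using key
  · intro z hz
    refine (hGg z (hd z (fun h => ?_) ?_ ?_).differentiableAt).symm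
    · exact ne_of_mem_frame hz (hSin z h).1 (hSin z h).2 rfl
    · rcases hz with h | h
      exacts [h.1, h.1.le]
    · rcases hz with h | h
      exacts [h.2.le, h.2]

end frame

/-! ### The residue theorem, principal parts and the basic contour estimate. -/

/-- The residue theorem for a rectangle, in terms of principal parts. -/
lemma rectIntegral_eq_sum {M T : ℝ} (hM : 0 < M) (hT : 0 < T) {κ : Type*} [DecidableEq κ]
    (S : Finset κ) (pole : κ → ℂ) (hinj : Set.InjOn pole S)
    (hin : ∀ i ∈ S, |(pole i).re| < M ∧ |(pole i).im| < T) {f : ℂ → ℂ} {P : κ → ℂ → ℂ}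
    (hP : ∀ i ∈ S, ∀ z, z ≠ pole i → AnalyticAt ℂ (P i) z)
    (hPm : ∀ i ∈ S, MeromorphicAt (P i) (pole i))
    (hf : ∀ z, (∀ i ∈ S, z ≠ pole i) → |z.re| ≤ M → |z.im| ≤ T → AnalyticAt ℂ f z)
    (hfm : ∀ i ∈ S, MeromorphicAt f (pole i))
    (hb : ∀ i ∈ S, (fun z => f z - P i z) =O[𝓝[≠] (pole i)] (fun _ => (1 : ℂ))) :
    rectIntegral f M T = ∑ i ∈ S, rectIntegral (P i) M T := by
  have hne : ∀ z ∈ frame M T, ∀ i ∈ S, z ≠ pole i := fun z hz i hi =>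
    ne_of_mem_frame hz (hin i hi).1 (hin i hi).2
  have hPc : ∀ i ∈ S, ContinuousOn (P i) (frame M T) := fun i hi z hz =>
    (hP i hi z (hne z hz i hi)).continuousAt.continuousWithinAt
  have hfc : ContinuousOn f (frame M T) := fun z hz =>
    (hf z (hne z hz) (by rcases hz with h | h; exacts [h.1, h.1.le])
      (by rcases hz with h | h; exacts [h.2.le, h.2])).continuousAt.continuousWithinAt
  have key := rectIntegral_eq_zero_of_isBigO hM hT (g := fun z => f z - ∑ i ∈ S, P i z)
    {p | ∃ i ∈ S, p = pole i}
    (by rintro p ⟨i, hi, rfl⟩; exact hin i hi)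
    (by
      intro z hz h1 h2
      have hz' : ∀ i ∈ S, z ≠ pole i := fun i hi h => hz ⟨i, hi, h⟩
      exact (hf z hz' h1 h2).sub
        (Finset.analyticAt_fun_sum _ fun i hi => hP i hi z (hz' i hi)))
    (by
      rintro p ⟨i, hi, rfl⟩
      have hcont : ∀ j ∈ S.erase i, AnalyticAt ℂ (P j) (pole i) := fun j hj =>
        hP j (Finset.mem_of_mem_erase hj) _ fun h =>
          (Finset.ne_of_mem_erase hj) (hinj hi (Finset.mem_of_mem_erase hj) h).symm
      constructor
      · refine (hfm i hi).sub (MeromorphicAt.fun_sum fun j hj => ?_)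
        by_cases hji : j = i
        · exact hji ▸ hPm i hi
        · exact (hcont j (Finset.mem_erase.2 ⟨hji, hj⟩)).meromorphicAt
      · have h1 : (fun z => ∑ j ∈ S.erase i, P j z) =O[𝓝[≠] (pole i)] (fun _ => (1 : ℂ)) :=
          ((Finset.analyticAt_fun_sum _ hcont).continuousAt.tendsto.mono_left
            nhdsWithin_le_nhds).isBigO_one ℂ
        refine ((hb i hi).sub h1).congr_left fun z => ?_
        rw [← Finset.add_sum_erase _ _ hi]
        ring)
  rw [rectIntegral_sub hM.le hT.le hfc (continuousOn_finsetSum _ hPc),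
    rectIntegral_sum hM.le hT.le S hPc, sub_eq_zero] at key
  exact key

/-- The principal part of a quotient at a simple zero of the denominator. -/
lemma div_sub_residue_isBigO_one {E q : ℂ → ℂ} {p q' : ℂ} (hE : AnalyticAt ℂ E p)
    (hq : AnalyticAt ℂ q p) (hq0 : q p = 0) (hq1 : HasDerivAt q q' p) (hq' : q' ≠ 0) :
    (fun z => E z / q z - E p / q' * (z - p)⁻¹) =O[𝓝[≠] p] (fun _ => (1 : ℂ)) := by
  have hdslope : ∀ {g : ℂ → ℂ}, AnalyticAt ℂ g p → AnalyticAt ℂ (dslope g p) p := by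
    rintro g ⟨r, hr⟩
    exact ⟨_, hr.has_fpower_series_dslope_fslope⟩
  have hd : dslope q p p = q' := by rw [dslope_same, hq1.deriv]
  -- Dividing the zero out of `q` gives `E / q = φ / (z - p)` near `p`, so the difference to be
  -- bounded is `dslope φ p`, which is analytic.
  set φ : ℂ → ℂ := fun z => E z / dslope q p z with hφ
  have hφa : AnalyticAt ℂ φ p := hE.div (hdslope hq) (by rwa [hd])
  have h1 : dslope φ p =O[𝓝[≠] p] (fun _ => (1 : ℂ)) :=
    ((hdslope hφa).continuousAt.tendsto.mono_left nhdsWithin_le_nhds).isBigO_one ℂ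
  refine h1.congr' ?_ EventuallyEq.rfl
  filter_upwards [self_mem_nhdsWithin] with z hz
  have hz' : z - p ≠ 0 := sub_ne_zero.2 hz
  rw [dslope_of_ne _ hz, slope_def_field, hφ]
  simp only
  rw [hd, dslope_of_ne _ hz, slope_def_field, hq0, sub_zero, div_div_eq_mul_div, sub_div,
    mul_div_assoc, mul_comm (E z), mul_div_assoc, ← div_eq_mul_inv, mul_comm]
  congr 1
  field_simp

/-- Substitute `y ↦ -y` and use that `θ / z` is odd. This is what makes opposite constants on the
two vertical sides cancel. -/
lemma rectIntegral_inv_comp_neg {M T : ℝ} (θ : ℂ) :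
    ∫ y in (-T)..T, θ / ((M : ℂ) + y * Complex.I)
      = - ∫ y in (-T)..T, θ / (((-M : ℝ) : ℂ) + y * Complex.I) := by
  rw [← intervalIntegral.integral_neg]
  have := intervalIntegral.integral_comp_neg (a := -T) (b := T)
    (fun y : ℝ => θ / ((M : ℂ) + y * Complex.I))
  rw [neg_neg] at this
  rw [← this]
  congr 1
  ext y
  rw [← div_neg]
  congr 1
  push_cast
  ring

/-- The integral of `H z / z` is small if `H` is bounded on the horizontal sides and close to the
opposite constants `±θ` on the vertical sides. -/
lemma norm_rectIntegral_div_le {M T : ℝ} (hM : 0 < M) (hT : 0 < T) {H : ℂ → ℂ} {θ : ℂ}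
    {B ε : ℝ} (hc : ContinuousOn H (frame M T))
    (hB : ∀ z ∈ frame M T, |z.im| = T → ‖H z‖ ≤ B)
    (hr : ∀ z ∈ frame M T, z.re = M → ‖H z - θ‖ ≤ ε)
    (hl : ∀ z ∈ frame M T, z.re = -M → ‖H z + θ‖ ≤ ε) :
    ‖rectIntegral (fun z => H z / z) M T‖ ≤ 4 * M * (B / T) + 4 * T * (ε / M) := by
  have h0 : ∀ z ∈ frame M T, z ≠ 0 := fun z hz => ne_of_mem_frame hz (by simpa) (by simpa)
  have hfc : ContinuousOn (fun z => H z / z) (frame M T) := hc.div continuousOn_id h0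
  have hgc : ContinuousOn (fun z => θ / z) (frame M T) := continuousOn_const.div continuousOn_id h0
  have hB0 : 0 ≤ B := (norm_nonneg _).trans (hB _ (top_mem_frame hM.le hT.le (x := M) (by simp))
    (by simp [abs_of_pos hT]))
  have hε0 : 0 ≤ ε := (norm_nonneg _).trans (hr _ (right_mem_frame hM.le hT.le (y := T) (by simp))
    (by simp))
  have him : ∀ z : ℂ, |z.im| = T → T ≤ ‖z‖ := fun z hz => hz ▸ Complex.abs_im_le_norm z
  have hre : ∀ z : ℂ, |z.re| = M → M ≤ ‖z‖ := fun z hz => hz ▸ Complex.abs_re_le_norm z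
  have hb : ‖∫ x in (-M)..M, H (x + (-T : ℝ) * Complex.I) / (x + (-T : ℝ) * Complex.I)‖
      ≤ B / T * |M - -M| := by
    refine intervalIntegral.norm_integral_le_of_norm_le_const fun x hx => ?_
    have hmem := bottom_mem_frame hM.le hT.le (Set.uIoc_subset_uIcc hx)
    have h : |((x : ℂ) + (-T : ℝ) * Complex.I).im| = T := by simp [abs_of_pos hT]
    rw [norm_div]
    exact div_le_div₀ hB0 (hB _ hmem h) hT (him _ h)
  have ht : ‖∫ x in (-M)..M, H (x + T * Complex.I) / (x + T * Complex.I)‖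
      ≤ B / T * |M - -M| := by
    refine intervalIntegral.norm_integral_le_of_norm_le_const fun x hx => ?_
    have hmem := top_mem_frame hM.le hT.le (Set.uIoc_subset_uIcc hx)
    have h : |((x : ℂ) + T * Complex.I).im| = T := by simp [abs_of_pos hT]
    rw [norm_div]
    exact div_le_div₀ hB0 (hB _ hmem h) hT (him _ h)
  have hr' : ‖∫ y in (-T)..T, (H (M + y * Complex.I) / (M + y * Complex.I)
      - θ / (M + y * Complex.I))‖ ≤ ε / M * |T - -T| := by
    refine intervalIntegral.norm_integral_le_of_norm_le_const fun x hx => ?_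
    have hmem := right_mem_frame hM.le hT.le (Set.uIoc_subset_uIcc hx)
    rw [← sub_div, norm_div]
    exact div_le_div₀ hε0 (hr _ hmem (by simp)) hM (hre _ (by simp [abs_of_pos hM]))
  have hl' : ‖∫ y in (-T)..T, (H ((-M : ℝ) + y * Complex.I) / ((-M : ℝ) + y * Complex.I)
      + θ / ((-M : ℝ) + y * Complex.I))‖ ≤ ε / M * |T - -T| := by
    refine intervalIntegral.norm_integral_le_of_norm_le_const fun x hx => ?_
    have hmem := left_mem_frame hM.le hT.le (Set.uIoc_subset_uIcc hx)
    rw [← add_div, norm_div]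
    exact div_le_div₀ hε0 (hl _ hmem (by simp)) hM (hre _ (by simp [abs_of_pos hM]))
  have e1 := intervalIntegral.integral_sub (intervalIntegrable_right hM.le hT.le hfc)
    (intervalIntegrable_right hM.le hT.le hgc)
  have e2 := intervalIntegral.integral_add (intervalIntegrable_left hM.le hT.le hfc)
    (intervalIntegrable_left hM.le hT.le hgc)
  have e3 := rectIntegral_inv_comp_neg (M := M) (T := T) θ
  have hsplit : rectIntegral (fun z => H z / z) M T
      = (∫ x in (-M)..M, H (x + (-T : ℝ) * Complex.I) / (x + (-T : ℝ) * Complex.I))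
        - (∫ x in (-M)..M, H (x + T * Complex.I) / (x + T * Complex.I))
        + Complex.I * (∫ y in (-T)..T, (H (M + y * Complex.I) / (M + y * Complex.I)
          - θ / (M + y * Complex.I)))
        - Complex.I * (∫ y in (-T)..T, (H ((-M : ℝ) + y * Complex.I) / ((-M : ℝ) + y * Complex.I)
          + θ / ((-M : ℝ) + y * Complex.I))) := by
    unfold rectIntegral
    rw [e1, e2, e3]
    ring
  rw [show M - -M = 2 * M by ring, abs_of_pos (by linarith)] at hb ht
  rw [show T - -T = 2 * T by ring, abs_of_pos (by linarith)] at hr' hl'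
  rw [hsplit]
  refine (norm_sub_le _ _).trans ?_
  refine (add_le_add_left (norm_add_le _ _) _).trans ?_
  refine (add_le_add_left (add_le_add_left (norm_sub_le _ _) _) _).trans ?_
  simp only [norm_mul, Complex.norm_I, one_mul]
  linarith

/-! ### The remainder function and its behaviour in the two half-planes. -/

section lattice

variable {ι : Type*} [Fintype ι]

/-- The Heaviside function with the value `1/2` at zero. -/
noncomputable def halfStep (y : ℝ) : ℝ := if y < 0 then 0 else if y = 0 then 1 / 2 else 1

/-- The linear form `∑ n_j α_j`. -/
noncomputable def linForm (α : ι → ℝ) (n : ι → ℕ) : ℝ := ∑ j, n j * α j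

lemma norm_exp_ofReal_mul (y : ℝ) (s : ℂ) : ‖Complex.exp (y * s)‖ = Real.exp (y * s.re) := by
  rw [Complex.norm_exp, Complex.re_ofReal_mul]

lemma exp_mul_prod_exp_pow (α : ι → ℝ) (u : ℝ) (s : ℂ) (n : ι → ℕ) :
    Complex.exp (u * s) * ∏ j, Complex.exp (-(α j * s)) ^ n j
      = Complex.exp ((u - linForm α n : ℝ) * s) := by
  simp_rw [← Complex.exp_nat_mul]
  rw [← Complex.exp_sum, ← Complex.exp_add]
  congr 1
  unfold linForm
  push_cast
  rw [sub_mul, Finset.sum_mul, sub_eq_add_neg, ← Finset.sum_neg_distrib]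
  congr 1
  exact Finset.sum_congr rfl fun j _ => by ring

variable [DecidableEq ι]

/-- The box `{0, …, K - 1} ^ ι`. -/
def latticeBox (ι : Type*) [Fintype ι] [DecidableEq ι] (K : ℕ) : Finset (ι → ℕ) :=
  Fintype.piFinset fun _ => Finset.range K

/-- `e ^ (u s) / ∏ (1 - e ^ (- α_j s))` minus the terms of its expansion with a nonnegative
exponent, the constant term being halved. -/
noncomputable def expRemainder (α : ι → ℝ) (u : ℝ) (K : ℕ) (s : ℂ) : ℂ :=
  Complex.exp (u * s) * ∏ j, (1 - Complex.exp (-(α j * s)))⁻¹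
    - ∑ n ∈ latticeBox ι K, (halfStep (u - linForm α n) : ℂ)
        * Complex.exp ((u - linForm α n : ℝ) * s)

lemma exists_pos_forall_le {κ : Type*} (S : Finset κ) (f : κ → ℝ) (hf : ∀ i ∈ S, 0 < f i) :
    ∃ d > 0, ∀ i ∈ S, d ≤ f i := by
  rcases S.eq_empty_or_nonempty with rfl | hS
  · exact ⟨1, one_pos, by simp⟩
  · obtain ⟨i, hi, h⟩ := S.exists_min_image f hS
    exact ⟨f i, hf i hi, h⟩

/-- Telescoping: the factors are exchanged one at a time. -/
lemma norm_prod_sub_prod_le_card_mul {κ : Type*} [DecidableEq κ] (S : Finset κ) {x y : κ → ℂ}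
    {B ε : ℝ} (hB : 1 ≤ B) (hε : 0 ≤ ε) (hx : ∀ i ∈ S, ‖x i‖ ≤ B) (hy : ∀ i ∈ S, ‖y i‖ ≤ B)
    (hxy : ∀ i ∈ S, ‖x i - y i‖ ≤ ε) :
    ‖∏ i ∈ S, x i - ∏ i ∈ S, y i‖ ≤ S.card * B ^ S.card * ε := by
  induction S using Finset.induction_on with
  | empty => simp
  | insert a S ha ih =>
    have ih' := ih (fun i hi => hx i (Finset.mem_insert_of_mem hi))
      (fun i hi => hy i (Finset.mem_insert_of_mem hi))
      (fun i hi => hxy i (Finset.mem_insert_of_mem hi))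
    rw [Finset.prod_insert ha, Finset.prod_insert ha, Finset.card_insert_of_notMem ha]
    have hp : ‖∏ i ∈ S, y i‖ ≤ B ^ S.card := by
      rw [norm_prod, ← Finset.prod_const]
      exact Finset.prod_le_prod (fun _ _ => norm_nonneg _)
        fun i hi => hy i (Finset.mem_insert_of_mem hi)
    have h1 := hx a (Finset.mem_insert_self _ _)
    have h2 := hxy a (Finset.mem_insert_self _ _)
    calc ‖x a * ∏ i ∈ S, x i - y a * ∏ i ∈ S, y i‖
        = ‖x a * (∏ i ∈ S, x i - ∏ i ∈ S, y i) + (x a - y a) * ∏ i ∈ S, y i‖ := by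
          congr 1; ring
      _ ≤ B * (S.card * B ^ S.card * ε) + ε * B ^ S.card := by
          refine (norm_add_le _ _).trans ?_
          rw [norm_mul, norm_mul]
          gcongr
      _ ≤ B * (S.card * B ^ S.card * ε) + ε * B ^ (S.card + 1) := by
          gcongr
          omega
      _ = _ := by push_cast; ring

/-- The value of the half-step sum at the jump, if any. -/
noncomputable def jumpTerm (α : ι → ℝ) (u : ℝ) (K : ℕ) : ℝ :=
  ∑ n ∈ latticeBox ι K, if u = linForm α n then 1 / 2 else 0

/-- A common exponential rate for all the exponents that occur. -/
lemma exists_rate [Nonempty ι] (α : ι → ℝ) (hα : ∀ j, 0 < α j) {u : ℝ} {K : ℕ}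
    (hK : ∀ j, u < K * α j) :
    ∃ d > 0, (∀ n ∈ latticeBox ι K, u ≠ linForm α n → d ≤ |u - linForm α n|) ∧
      (∀ j, d + u ≤ K * α j) ∧ d ≤ ∑ j, α j := by
  obtain ⟨d1, h1, h1'⟩ := exists_pos_forall_le
    ((latticeBox ι K).filter fun n => u ≠ linForm α n) (fun n => |u - linForm α n|)
    (fun n hn => abs_pos.2 (sub_ne_zero.2 (Finset.mem_filter.1 hn).2))
  obtain ⟨d2, h2, h2'⟩ := exists_pos_forall_le (Finset.univ : Finset ι) (fun j => K * α j - u)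
    (fun j _ => sub_pos.2 (hK j))
  have h3 : 0 < ∑ j, α j := Finset.sum_pos (fun j _ => hα j) Finset.univ_nonempty
  refine ⟨min d1 (min d2 (∑ j, α j)), by positivity, fun n hn h => ?_, fun j => ?_, ?_⟩
  · exact (min_le_left _ _).trans (h1' n (Finset.mem_filter.2 ⟨hn, h⟩))
  · have := h2' j (Finset.mem_univ j)
    have h4 : min d1 (min d2 (∑ j, α j)) ≤ d2 := (min_le_right _ _).trans (min_le_left _ _)
    linarith
  · exact (min_le_right _ _).trans (min_le_right _ _)

/-- Each factor `1/(1 - z_j)` is replaced by its geometric sum of length `K`. The tail `z_j^K/(1 -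
z_j)` has size `e^(-K α_j Re s)`, which beats `e^(u Re s)` by the margin `d`. Of the finite sum
there remain the terms with negative exponent, which decay, and half of each constant term, which
make up `jumpTerm`. -/
lemma norm_expRemainder_sub_le (α : ι → ℝ) (hα : ∀ j, 0 < α j) {u d κ : ℝ} {K : ℕ}
    (hd1 : ∀ n ∈ latticeBox ι K, u ≠ linForm α n → d ≤ |u - linForm α n|)
    (hd2 : ∀ j, d + u ≤ K * α j) (hκ : 0 < κ) {s : ℂ} (hs : 0 ≤ s.re)
    (hsep : ∀ j, κ ≤ ‖1 - Complex.exp (-(α j * s))‖) :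
    ‖expRemainder α u K s - jumpTerm α u K‖
      ≤ ((latticeBox ι K).card + Fintype.card ι * (K + κ⁻¹ + 1) ^ Fintype.card ι * κ⁻¹)
        * Real.exp (-(d * s.re)) := by
  set z : ι → ℂ := fun j => Complex.exp (-(α j * s)) with hz
  have hz1 : ∀ j, 1 - z j ≠ 0 := fun j => norm_pos_iff.1 (hκ.trans_le (hsep j))
  have hznorm : ∀ j, ‖z j‖ = Real.exp (-(α j * s.re)) := fun j => by
    rw [hz]; simp only
    rw [← neg_mul, ← Complex.ofReal_neg, norm_exp_ofReal_mul, neg_mul]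
  have hzle : ∀ j, ‖z j‖ ≤ 1 := fun j => by
    rw [hznorm, Real.exp_le_one_iff]
    have := mul_nonneg (hα j).le hs
    linarith
  have hbox : Complex.exp (u * s) * ∏ j, ∑ p ∈ Finset.range K, z j ^ p
      = ∑ n ∈ latticeBox ι K, Complex.exp ((u - linForm α n : ℝ) * s) := by
    rw [Finset.prod_univ_sum, Finset.mul_sum]
    exact Finset.sum_congr rfl fun n _ => exp_mul_prod_exp_pow α u s n
  have hgeom : ∀ j, (1 - z j)⁻¹ - ∑ p ∈ Finset.range K, z j ^ p = z j ^ K * (1 - z j)⁻¹ := by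
    intro j
    have h := geom_sum_mul_neg (z j) K
    field_simp [hz1 j]
    linear_combination -h
  have hsplit : expRemainder α u K s - jumpTerm α u K
      = (∑ n ∈ latticeBox ι K, ((1 - halfStep (u - linForm α n) : ℂ)
          * Complex.exp ((u - linForm α n : ℝ) * s) - (if u = linForm α n then 1 / 2 else 0 : ℝ)))
        + Complex.exp (u * s)
          * (∏ j, (1 - z j)⁻¹ - ∏ j, ∑ p ∈ Finset.range K, z j ^ p) := by
    rw [mul_sub, hbox]
    unfold expRemainder jumpTerm
    simp only [Finset.sum_sub_distrib, sub_mul, one_mul, Complex.ofReal_sum]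
    ring
  rw [hsplit, add_mul]
  refine (norm_add_le _ _).trans (add_le_add ?_ ?_)
  · rw [← nsmul_eq_mul]
    refine norm_sum_le_of_le _ (fun n hn => ?_) |>.trans (Finset.sum_const _).le
    rcases lt_trichotomy (u - linForm α n) 0 with h | h | h
    · have hne : u ≠ linForm α n := by intro h'; rw [h', sub_self] at h; exact lt_irrefl _ h
      rw [halfStep, if_pos h, if_neg hne, Complex.ofReal_zero, sub_zero, sub_zero, one_mul,
        norm_exp_ofReal_mul, Real.exp_le_exp]
      have := hd1 n hn hne
      rw [abs_of_neg h] at this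
      nlinarith
    · have hne : u = linForm α n := sub_eq_zero.1 h
      rw [halfStep, if_pos hne, h, if_neg (lt_irrefl _), if_pos rfl]
      have : ‖((1 : ℂ) - ((1 / 2 : ℝ) : ℂ)) * Complex.exp ((0 : ℝ) * s) - ((1 / 2 : ℝ) : ℂ)‖ = 0 := by
        rw [norm_eq_zero]; push_cast; rw [zero_mul, Complex.exp_zero]; ring
      rw [this]
      positivity
    · have hne : u ≠ linForm α n := by intro h'; rw [h', sub_self] at h; exact lt_irrefl _ h
      rw [halfStep, if_neg h.not_gt, if_neg h.ne', if_neg hne]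
      simp only [Complex.ofReal_one, sub_self, zero_mul, Complex.ofReal_zero, norm_zero]
      positivity
  · have hκ' : 0 < κ⁻¹ := inv_pos.2 hκ
    have hinv : ∀ j, ‖(1 - z j)⁻¹‖ ≤ κ⁻¹ := fun j => by
      rw [norm_inv]; exact inv_anti₀ hκ (hsep j)
    have hK0 : (0 : ℝ) ≤ K := Nat.cast_nonneg K
    have h := norm_prod_sub_prod_le_card_mul (Finset.univ : Finset ι)
      (x := fun j => (1 - z j)⁻¹) (y := fun j => ∑ p ∈ Finset.range K, z j ^ p)
      (B := K + κ⁻¹ + 1) (ε := κ⁻¹ * Real.exp (-((d + u) * s.re))) (by linarith) (by positivity)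
      (fun j _ => (hinv j).trans (by linarith))
      (fun j _ => by
        refine (norm_sum_le_of_le _ (fun p _ => ?_)).trans
          (b := ∑ _p ∈ Finset.range K, (1 : ℝ)) (by simp; linarith)
        rw [norm_pow]
        exact pow_le_one₀ (norm_nonneg _) (hzle j))
      (fun j _ => by
        rw [hgeom, norm_mul, norm_pow, hznorm, ← Real.exp_nat_mul, mul_comm]
        refine mul_le_mul (hinv j) ?_ (Real.exp_nonneg _) hκ'.le
        rw [Real.exp_le_exp]
        have := hd2 j
        nlinarith)
    rw [norm_mul, norm_exp_ofReal_mul]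
    refine (mul_le_mul_of_nonneg_left h (Real.exp_nonneg _)).trans (le_of_eq ?_)
    rw [Finset.card_univ]
    have : Real.exp (-(d * s.re)) = Real.exp (u * s.re) * Real.exp (-((d + u) * s.re)) := by
      rw [← Real.exp_add]; congr 1; ring
    rw [this]
    ring

/-- To the left, `1/(1 - z) = (-1 + 1/(1 - z)) e^(αs)`, so the whole product decays like `e^((∑ α_j)
Re s)`, and `u ≥ 0` keeps `e^(us)` bounded. The subtracted terms with positive exponent decay as
well, and the halved constant terms survive with a minus sign. -/
lemma norm_expRemainder_add_le (α : ι → ℝ) {u d κ : ℝ} {K : ℕ}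
    (hu : 0 ≤ u)
    (hd1 : ∀ n ∈ latticeBox ι K, u ≠ linForm α n → d ≤ |u - linForm α n|)
    (hd3 : d ≤ ∑ j, α j) (hκ : 0 < κ) {s : ℂ} (hs : s.re ≤ 0)
    (hsep : ∀ j, κ ≤ ‖1 - Complex.exp (-(α j * s))‖) :
    ‖expRemainder α u K s + jumpTerm α u K‖
      ≤ ((1 + κ⁻¹) ^ Fintype.card ι + (latticeBox ι K).card) * Real.exp (d * s.re) := by
  set z : ι → ℂ := fun j => Complex.exp (-(α j * s)) with hz
  have hz1 : ∀ j, 1 - z j ≠ 0 := fun j => norm_pos_iff.1 (hκ.trans_le (hsep j))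
  have hinv : ∀ j, ‖(1 - z j)⁻¹‖ ≤ (1 + κ⁻¹) * Real.exp (α j * s.re) := fun j => by
    have h1 : (1 - z j)⁻¹ = (-1 + (1 - z j)⁻¹) * Complex.exp (α j * s) := by
      have h2 : Complex.exp (α j * s) = (z j)⁻¹ := by rw [hz]; simp [Complex.exp_neg]
      have h3 : z j ≠ 0 := Complex.exp_ne_zero _
      have h4 := hz1 j
      rw [h2]
      field_simp
      ring
    rw [h1, norm_mul, norm_exp_ofReal_mul]
    gcongr
    refine (norm_add_le _ _).trans ?_
    rw [norm_neg, norm_one, norm_inv]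
    gcongr
    exact hsep j
  have hsplit : expRemainder α u K s + jumpTerm α u K
      = Complex.exp (u * s) * ∏ j, (1 - z j)⁻¹ -
        ∑ n ∈ latticeBox ι K, ((halfStep (u - linForm α n) : ℂ)
          * Complex.exp ((u - linForm α n : ℝ) * s)
            - (if u = linForm α n then 1 / 2 else 0 : ℝ)) := by
    unfold expRemainder jumpTerm
    simp only [Finset.sum_sub_distrib, Complex.ofReal_sum]
    ring
  rw [hsplit, add_mul]
  refine (norm_sub_le _ _).trans (add_le_add ?_ ?_)
  · rw [norm_mul, norm_exp_ofReal_mul, norm_prod]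
    have h1 : Real.exp (u * s.re) ≤ 1 := by
      rw [Real.exp_le_one_iff]; exact mul_nonpos_of_nonneg_of_nonpos hu hs
    have h2 : ∏ j, ‖(1 - z j)⁻¹‖ ≤ ∏ j, ((1 + κ⁻¹) * Real.exp (α j * s.re)) :=
      Finset.prod_le_prod (fun _ _ => norm_nonneg _) fun j _ => hinv j
    rw [Finset.prod_mul_distrib, Finset.prod_const, Finset.card_univ, ← Real.exp_sum,
      ← Finset.sum_mul] at h2
    have h3 : Real.exp ((∑ j, α j) * s.re) ≤ Real.exp (d * s.re) := by
      rw [Real.exp_le_exp]; nlinarith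
    have hκ' : 0 < κ⁻¹ := inv_pos.2 hκ
    calc _ ≤ 1 * ((1 + κ⁻¹) ^ Fintype.card ι * Real.exp (d * s.re)) := by
          refine mul_le_mul h1 (h2.trans ?_) (Finset.prod_nonneg fun _ _ => norm_nonneg _) zero_le_one
          gcongr
      _ = _ := one_mul _
  · rw [← nsmul_eq_mul]
    refine norm_sum_le_of_le _ (fun n hn => ?_) |>.trans (Finset.sum_const _).le
    rcases lt_trichotomy (u - linForm α n) 0 with h | h | h
    · have hne : u ≠ linForm α n := by intro h'; rw [h', sub_self] at h; exact lt_irrefl _ h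
      rw [halfStep, if_pos h, if_neg hne, Complex.ofReal_zero, sub_zero, zero_mul, norm_zero]
      positivity
    · have hne : u = linForm α n := sub_eq_zero.1 h
      rw [halfStep, if_pos hne, h, if_neg (lt_irrefl _), if_pos rfl]
      simp only [Complex.ofReal_zero, zero_mul, Complex.exp_zero, mul_one, sub_self, norm_zero]
      positivity
    · have hne : u ≠ linForm α n := by intro h'; rw [h', sub_self] at h; exact lt_irrefl _ h
      rw [halfStep, if_neg h.not_gt, if_neg h.ne', if_neg hne, Complex.ofReal_one, one_mul,
        Complex.ofReal_zero, sub_zero, norm_exp_ofReal_mul, Real.exp_le_exp]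
      have := hd1 n hn hne
      rw [abs_of_pos h] at this
      nlinarith

end lattice

/-! ### Poles, residues and principal parts. -/

section limit

variable {ι : Type*}

/-- The number `2πik/α_j`. -/
noncomputable def expPole (α : ι → ℝ) (j : ι) (k : ℤ) : ℂ :=
  2 * Real.pi * Complex.I * k / α j

/-- The residue of `e ^ (u s) / (s ∏ (1 - e ^ (- α_i s)))` at `2πik/α_j`. -/
noncomputable def expResidue [Fintype ι] [DecidableEq ι] (α : ι → ℝ) (u : ℝ) (j : ι) (k : ℤ) : ℂ :=
  Complex.exp (u * expPole α j k) / expPole α j k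
    * (∏ i ∈ Finset.univ.erase j, (1 - Complex.exp (-(α i * expPole α j k)))⁻¹) / α j

/-- The real numbers `R` such that every `R α_j` has distance at least `δ` from the integers. -/
def separatedSet (α : ι → ℝ) (δ : ℝ) : Set ℝ :=
  {R | ∀ j, ∀ m : ℤ, δ ≤ |R * α j - m|}

/-- Both quantities are compared with `|sin (πy)|`: it is at least twice the distance from `y` to
the nearest integer by Jordan's inequality, and at most `|1 - e^w|` whatever the modulus of `e^w`.
This bounds the factors on the horizontal sides. -/
lemma two_mul_le_norm_one_sub_exp {δ y : ℝ} (hy : ∀ m : ℤ, δ ≤ |y - m|) {w : ℂ}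
    (hw : |w.im| = |2 * Real.pi * y|) : 2 * δ ≤ ‖1 - Complex.exp w‖ := by
  have hcos : Real.cos w.im = Real.cos (2 * (Real.pi * y)) := by
    rw [← Real.cos_abs, hw, Real.cos_abs, mul_assoc]
  have hsin : 2 * δ ≤ |Real.sin (Real.pi * y)| := by
    have h1 : |Real.sin (Real.pi * y)| = |Real.sin (Real.pi * (y - round y))| := by
      have h3 : Real.pi * (y - round y) = Real.pi * y - round y * Real.pi := by ring
      rw [h3, Real.sin_sub_int_mul_pi, abs_mul]
      simp
    have h2 : |Real.pi * (y - round y)| ≤ Real.pi / 2 := by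
      rw [abs_mul, abs_of_pos Real.pi_pos]
      have := abs_sub_round y
      nlinarith [Real.pi_pos]
    have h3 := Real.mul_abs_le_abs_sin h2
    rw [h1]
    refine le_trans ?_ h3
    rw [abs_mul, abs_of_pos Real.pi_pos, ← mul_assoc, div_mul_cancel₀ _ Real.pi_pos.ne']
    linarith [hy (round y)]
  refine hsin.trans (abs_le_of_sq_le_sq' ?_ (norm_nonneg _) |> fun h => abs_le.2 h)
  rw [Complex.sq_norm, Complex.normSq_apply]
  simp only [Complex.sub_re, Complex.one_re, Complex.sub_im, Complex.one_im, Complex.exp_re,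
    Complex.exp_im]
  have h1 := Real.sin_sq_add_cos_sq w.im
  have h2 : Real.sin (Real.pi * y) ^ 2 = (1 - Real.cos w.im) / 2 := by
    rw [hcos, Real.cos_two_mul, Real.sin_sq]; ring
  have hr := Real.exp_pos w.re
  set r := Real.exp w.re
  set c := Real.cos w.im
  set t := Real.sin w.im
  have hc1 : c ≤ 1 := Real.cos_le_one _
  have hc2 : -1 ≤ c := Real.neg_one_le_cos _
  have : (1 - r * c) * (1 - r * c) + (0 - r * t) * (0 - r * t) = 1 - 2 * r * c + r ^ 2 := by
    linear_combination r ^ 2 * h1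
  rw [h2, this]
  -- The claim is `(1 - c)/2 ≤ 1 - 2rc + r²`. For very negative `c` the right side is at least `1`.
  -- Otherwise it equals `(r - c)² + (1 - c)(1 + c)` with `1 + c ≥ 1/2`.
  by_cases h : c ≤ -(1 / 2)
  · nlinarith
  · nlinarith [sq_nonneg (r - c), mul_nonneg (sub_nonneg.2 hc1) (by linarith : 0 ≤ 1 / 2 + c)]

/-- On the vertical sides `e^(-as)` has modulus at most `e^(-a)` or at least `e^a`. In the second
case `e^a - 1 ≥ 1 - e^(-a)`, because `e^a + e^(-a) ≥ 2`. -/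
lemma one_sub_exp_neg_le_norm {a M : ℝ} (ha : 0 < a) (hM : 1 ≤ M) {s : ℂ} (hs : |s.re| = M) :
    1 - Real.exp (-a) ≤ ‖1 - Complex.exp (-(a * s))‖ := by
  have hn : ‖Complex.exp (-(a * s))‖ = Real.exp (-(a * s.re)) := by
    rw [← neg_mul, ← Complex.ofReal_neg, norm_exp_ofReal_mul, neg_mul]
  have h1 := abs_norm_sub_norm_le (1 : ℂ) (Complex.exp (-(a * s)))
  rw [hn, norm_one, abs_le] at h1
  rcases le_total 0 s.re with h | h
  · rw [abs_of_nonneg h] at hs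
    have : Real.exp (-(a * s.re)) ≤ Real.exp (-a) := by
      rw [Real.exp_le_exp]; nlinarith
    linarith [h1.2]
  · rw [abs_of_nonpos h] at hs
    have h2 : Real.exp a ≤ Real.exp (-(a * s.re)) := by
      rw [Real.exp_le_exp]; nlinarith
    have h3 := Real.add_one_le_exp a
    have h4 := Real.add_one_le_exp (-a)
    linarith [h1.1]

lemma sum_Icc_neg_erase_zero {A : Type*} [AddCommMonoid A] (g : ℤ → A) (K : ℕ) :
    ∑ k ∈ (Finset.Icc (-(K : ℤ)) K).erase 0, g k = ∑ k ∈ Finset.Icc 1 K, (g k + g (-k)) := by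
  induction K with
  | zero => simp
  | succ K ih =>
    rw [Finset.sum_Icc_succ_top (by omega), ← ih]
    have : (Finset.Icc (-((K + 1 : ℕ) : ℤ)) ((K + 1 : ℕ) : ℤ)).erase 0
        = insert ((K + 1 : ℕ) : ℤ) (insert (-((K + 1 : ℕ) : ℤ))
          ((Finset.Icc (-(K : ℤ)) K).erase 0)) := by
      ext k
      simp only [Finset.mem_erase, Finset.mem_Icc, Finset.mem_insert]
      omega
    rw [this, Finset.sum_insert, Finset.sum_insert]
    · rw [← add_assoc, add_comm]
    · simp
    · simp only [Finset.mem_insert, Finset.mem_erase, Finset.mem_Icc]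
      omega

lemma exists_expPole_of_exp_eq_one {α : ι → ℝ} {j : ι} (hα : 0 < α j) {s : ℂ}
    (h : 1 - Complex.exp (-(α j * s)) = 0) : ∃ m : ℤ, s = expPole α j m := by
  rw [sub_eq_zero, eq_comm, Complex.exp_neg, inv_eq_one, Complex.exp_eq_one_iff] at h
  obtain ⟨m, hm⟩ := h
  refine ⟨m, ?_⟩
  have : (α j : ℂ) ≠ 0 := by exact_mod_cast hα.ne'
  rw [expPole, eq_div_iff this, mul_comm, hm]
  ring

/-- A common pole of two factors is an integer relation between their exponents. Independence of the
`α_j` therefore makes every nonzero pole simple and all of them distinct. -/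
lemma expPole_eq_iff {α : ι → ℝ} (hα : ∀ j, 0 < α j) {i j : ι} {k m : ℤ} :
    expPole α i k = expPole α j m ↔ (k : ℝ) * α j = m * α i := by
  have h1 : (α i : ℂ) ≠ 0 := by exact_mod_cast (hα i).ne'
  have h2 : (α j : ℂ) ≠ 0 := by exact_mod_cast (hα j).ne'
  rw [expPole, expPole, div_eq_div_iff h1 h2, mul_assoc (2 * Real.pi * Complex.I),
    mul_assoc (2 * Real.pi * Complex.I),
    mul_right_inj' Complex.two_pi_I_ne_zero]
  norm_cast

lemma exp_mul_expPole {α : ι → ℝ} (hα : ∀ j, 0 < α j) (j : ι) (k : ℤ) :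
    Complex.exp (-(α j * expPole α j k)) = 1 := by
  rw [Complex.exp_neg, inv_eq_one, Complex.exp_eq_one_iff]
  have : (α j : ℂ) ≠ 0 := by exact_mod_cast (hα j).ne'
  exact ⟨k, by rw [expPole]; field_simp⟩

lemma expPole_eq_ofReal_mul_I (α : ι → ℝ) (j : ι) (k : ℤ) :
    expPole α j k = ((2 * Real.pi * k / α j : ℝ) : ℂ) * Complex.I := by
  rw [expPole]; push_cast; ring

lemma expPole_re (α : ι → ℝ) (j : ι) (k : ℤ) : (expPole α j k).re = 0 := by
  rw [expPole_eq_ofReal_mul_I, Complex.re_ofReal_mul]; simp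

lemma expPole_im (α : ι → ℝ) (j : ι) (k : ℤ) :
    (expPole α j k).im = 2 * Real.pi * k / α j := by
  rw [expPole_eq_ofReal_mul_I, Complex.im_ofReal_mul]; simp

lemma expPole_ne_zero {α : ι → ℝ} (hα : ∀ j, 0 < α j) (j : ι) {k : ℤ} (hk : k ≠ 0) :
    expPole α j k ≠ 0 := by
  have h2 : (α j : ℂ) ≠ 0 := by exact_mod_cast (hα j).ne'
  exact div_ne_zero (mul_ne_zero Complex.two_pi_I_ne_zero (Int.cast_ne_zero.2 hk)) h2

/-- Only the power `s⁻¹` fails to have a primitive on the frame. This evaluates the contribution of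
the multiple pole at zero. -/
lemma rectIntegral_polynomial_mul_zpow {M T : ℝ} (hM : 0 < M) (hT : 0 < T) (p : Polynomial ℂ)
    (n : ℕ) :
    rectIntegral (fun s => p.eval s * s ^ (-(n + 1 : ℤ))) M T
      = 2 * Real.pi * Complex.I * p.coeff n := by
  have h0 : ∀ z ∈ frame M T, z ≠ 0 := fun z hz => ne_of_mem_frame hz (by simpa) (by simpa)
  rw [rectIntegral_congr hM.le hT.le
    (g := fun s => ∑ i ∈ Finset.range (p.natDegree + 1), p.coeff i * s ^ ((i : ℤ) - (n + 1)))
    (by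
      intro z hz
      simp only
      rw [Polynomial.eval_eq_sum_range, Finset.sum_mul]
      refine Finset.sum_congr rfl fun i _ => ?_
      rw [sub_eq_add_neg, zpow_add₀ (h0 z hz), zpow_natCast, mul_assoc]),
    rectIntegral_sum hM.le hT.le (f := fun i s => p.coeff i * s ^ ((i : ℤ) - (n + 1))) _ (fun i _ => continuousOn_const.mul
      (continuousOn_id.zpow₀ _ fun z hz => Or.inl (h0 z hz)))]
  simp_rw [rectIntegral_const_mul, rectIntegral_zpow hM hT]
  have : ∀ i : ℕ, ((i : ℤ) - (n + 1) = -1) ↔ i = n := fun i => by omega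
  simp_rw [this, mul_ite, mul_zero]
  rw [Finset.sum_ite_eq']
  split_ifs with h
  · ring
  · rw [Polynomial.coeff_eq_zero_of_natDegree_lt (by simpa using h), mul_zero]

variable [Fintype ι] [DecidableEq ι]

/-- The sum of the residues up to height `R`. -/
noncomputable def residueSum (α : ι → ℝ) (u R : ℝ) : ℂ :=
  ∑ j, ∑ k ∈ Finset.Icc 1 ⌊R * α j⌋₊, (expResidue α u j k + expResidue α u j (-k))

lemma analyticAt_expRemainder_div {α : ι → ℝ} {u : ℝ} {K : ℕ} {s : ℂ} (hs : s ≠ 0)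
    (h : ∀ j, 1 - Complex.exp (-(α j * s)) ≠ 0) :
    AnalyticAt ℂ (fun s => expRemainder α u K s / s) s := by
  unfold expRemainder
  refine AnalyticAt.div (AnalyticAt.sub (AnalyticAt.mul (by fun_prop)
    (Finset.analyticAt_fun_prod _ fun j _ => AnalyticAt.inv (by fun_prop) (h j))) ?_)
    analyticAt_id hs
  exact Finset.analyticAt_fun_sum _ fun n _ => by fun_prop

lemma meromorphicAt_expRemainder_div (α : ι → ℝ) (u : ℝ) (K : ℕ) (s : ℂ) :
    MeromorphicAt (fun s => expRemainder α u K s / s) s := by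
  unfold expRemainder
  refine MeromorphicAt.div (MeromorphicAt.sub (MeromorphicAt.mul
    (AnalyticAt.meromorphicAt (by fun_prop)) (MeromorphicAt.fun_prod fun j _ =>
      MeromorphicAt.inv (AnalyticAt.meromorphicAt (by fun_prop)))) ?_)
    analyticAt_id.meromorphicAt
  exact AnalyticAt.meromorphicAt (Finset.analyticAt_fun_sum _ fun n _ => by fun_prop)

/-- The principal part at a nonzero pole. -/
lemma expRemainder_div_sub_residue_isBigO {α : ι → ℝ} (hα : ∀ j, 0 < α j)
    (hirr : ∀ i j, i ≠ j → ∀ k m : ℤ, k ≠ 0 → (k : ℝ) * α i ≠ m * α j) (u : ℝ) (K : ℕ)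
    (j : ι) {k : ℤ} (hk : k ≠ 0) :
    (fun s => expRemainder α u K s / s - expResidue α u j k * (s - expPole α j k)⁻¹)
      =O[𝓝[≠] (expPole α j k)] (fun _ => (1 : ℂ)) := by
  set p := expPole α j k with hp
  have hp0 : p ≠ 0 := expPole_ne_zero hα j hk
  have hne : ∀ i ∈ Finset.univ.erase j, 1 - Complex.exp (-(α i * p)) ≠ 0 := fun i hi h => by
    obtain ⟨m, hm⟩ := exists_expPole_of_exp_eq_one (hα i) h
    rw [hp, expPole_eq_iff hα] at hm
    exact hirr i j (Finset.ne_of_mem_erase hi) k m hk hm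
  have hαj : (α j : ℂ) ≠ 0 := by exact_mod_cast (hα j).ne'
  have hmain := div_sub_residue_isBigO_one (p := p) (q' := α j)
    (E := fun s => Complex.exp (u * s) / s
      * ∏ i ∈ Finset.univ.erase j, (1 - Complex.exp (-(α i * s)))⁻¹)
    (q := fun s => 1 - Complex.exp (-(α j * s)))
    ((AnalyticAt.div (by fun_prop) analyticAt_id hp0).mul
      (Finset.analyticAt_fun_prod _ fun i hi => AnalyticAt.inv (by fun_prop) (hne i hi)))
    (by fun_prop) (by rw [hp, exp_mul_expPole hα, sub_self])
    (by
      have h1 : HasDerivAt (fun s : ℂ => -((α j : ℂ) * s)) (-(α j : ℂ)) p := by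
        simpa using (hasDerivAt_id p).const_mul (-(α j : ℂ))
      have h2 := (h1.cexp).const_sub 1
      rw [hp, exp_mul_expPole hα] at h2
      simpa using h2) hαj
  -- The subtracted exponentials, divided by `s`, are analytic away from zero and do not change the
  -- principal part.
  have hE : AnalyticAt ℂ (fun s : ℂ => (∑ n ∈ latticeBox ι K, (halfStep (u - linForm α n) : ℂ)
        * Complex.exp ((u - linForm α n : ℝ) * s)) / s) p :=
    AnalyticAt.div (Finset.analyticAt_fun_sum _ fun n _ => by fun_prop) analyticAt_id hp0
  refine (hmain.sub ((hE.continuousAt.tendsto.mono_left nhdsWithin_le_nhds).isBigO_one ℂ)).congr_left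
    fun s => ?_
  unfold expRemainder expResidue
  rw [← Finset.mul_prod_erase _ _ (Finset.mem_univ j), ← hp]
  simp only [div_eq_mul_inv]
  ring

/-- The principal part at zero. -/
lemma expRemainder_div_sub_principal_isBigO {α : ι → ℝ} (u : ℝ) (K : ℕ) {p : Polynomial ℂ}
    (hp : (fun s : ℂ => Complex.exp (u * s) * ∏ j, (s * (1 - Complex.exp (-(α j * s)))⁻¹) - p.eval s)
      =O[𝓝[≠] 0] (fun s => s ^ (Fintype.card ι + 1))) :
    (fun s => expRemainder α u K s / s
      - (p.eval s * s ^ (-(Fintype.card ι + 1 : ℤ))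
        - (∑ n ∈ latticeBox ι K, (halfStep (u - linForm α n) : ℂ)) * s⁻¹))
      =O[𝓝[≠] 0] (fun _ => (1 : ℂ)) := by
  -- The subtracted exponentials give a simple pole at zero whose residue is their value there, the
  -- half-weighted count.
  have h1 := div_sub_residue_isBigO_one (p := (0 : ℂ)) (q' := 1)
    (E := fun s => ∑ n ∈ latticeBox ι K, (halfStep (u - linForm α n) : ℂ)
        * Complex.exp ((u - linForm α n : ℝ) * s)) (q := fun s => s)
    (Finset.analyticAt_fun_sum _ fun n _ => by fun_prop) analyticAt_id rfl (hasDerivAt_id _)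
    one_ne_zero
  have h2 := hp.mul (Asymptotics.isBigO_refl (fun s : ℂ => s ^ (-(Fintype.card ι + 1 : ℤ))) (𝓝[≠] 0))
  have h3 : (fun s : ℂ => s ^ (Fintype.card ι + 1) * s ^ (-(Fintype.card ι + 1 : ℤ)))
      =ᶠ[𝓝[≠] 0] fun _ => 1 := by
    filter_upwards [self_mem_nhdsWithin] with s hs
    rw [zpow_neg]
    exact mul_inv_cancel₀ (pow_ne_zero _ hs)
  refine ((h2.trans_eventuallyEq h3).sub h1).congr' ?_ EventuallyEq.rfl
  filter_upwards [self_mem_nhdsWithin] with s hs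
  have hs : s ≠ 0 := hs
  have h4 : s ^ (-(Fintype.card ι + 1 : ℤ)) = (s ^ Fintype.card ι)⁻¹ * s⁻¹ := by
    rw [zpow_neg, ← mul_inv, ← pow_succ]
    norm_cast
  rw [Finset.prod_mul_distrib, Finset.prod_const, Finset.card_univ, h4]
  unfold expRemainder
  simp only [mul_zero, Complex.exp_zero, mul_one, div_one, sub_zero]
  field_simp
  ring

end limit

/-! ### The residue theorem applied to the remainder, and the limit theorem. -/

section limit

variable {ι : Type*} [Fintype ι] [DecidableEq ι]

/-- The singularities inside the rectangle of height `2πR`; `none` stands for zero. -/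
noncomputable def poleIndex (α : ι → ℝ) (R : ℝ) : Finset (Option (Σ _ : ι, ℤ)) :=
  (Finset.univ.sigma fun j => (Finset.Icc (-(⌊R * α j⌋₊ : ℤ)) ⌊R * α j⌋₊).erase 0).insertNone

noncomputable def indexedPole (α : ι → ℝ) : Option (Σ _ : ι, ℤ) → ℂ
  | none => 0
  | some x => expPole α x.1 x.2

/-- At zero this is a principal part only up to an analytic function: `p` may have degree above
`card ι`, and the extra nonnegative powers integrate to zero. -/
noncomputable def principalPart (α : ι → ℝ) (u : ℝ) (K : ℕ) (p : Polynomial ℂ) :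
    Option (Σ _ : ι, ℤ) → ℂ → ℂ
  | none => fun s => p.eval s * s ^ (-(Fintype.card ι + 1 : ℤ))
      - (∑ n ∈ latticeBox ι K, (halfStep (u - linForm α n) : ℂ)) * s⁻¹
  | some x => fun s => expResidue α u x.1 x.2 * (s - expPole α x.1 x.2)⁻¹

omit [DecidableEq ι] in
lemma some_mem_poleIndex {α : ι → ℝ} {R : ℝ} {x : Σ _ : ι, ℤ} :
    some x ∈ poleIndex α R ↔ x.2 ≠ 0 ∧ |x.2| ≤ (⌊R * α x.1⌋₊ : ℤ) := by
  simp [poleIndex, Finset.mem_insertNone, abs_le]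

/-- The pole with index `k` has height `2πk/α_j`, so `|k| ≤ ⌊R α_j⌋` selects the poles inside the
rectangle. Separation of `R` keeps every pole off its horizontal sides. -/
lemma rectIntegral_expRemainder_div {α : ι → ℝ} (hα : ∀ j, 0 < α j)
    (hirr : ∀ i j, i ≠ j → ∀ k m : ℤ, k ≠ 0 → (k : ℝ) * α i ≠ m * α j) (u : ℝ) (K : ℕ)
    {p : Polynomial ℂ}
    (hp : (fun s : ℂ => Complex.exp (u * s) * ∏ j, (s * (1 - Complex.exp (-(α j * s)))⁻¹) - p.eval s)
      =O[𝓝[≠] 0] (fun s => s ^ (Fintype.card ι + 1)))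
    {δ R M : ℝ} (hδ : 0 < δ) (hR : 0 < R) (hM : 0 < M) (hsep : R ∈ separatedSet α δ) :
    rectIntegral (fun s => expRemainder α u K s / s) M (2 * Real.pi * R)
      = 2 * Real.pi * Complex.I * (p.coeff (Fintype.card ι) + residueSum α u R
        - ∑ n ∈ latticeBox ι K, (halfStep (u - linForm α n) : ℂ)) := by
  have hT : 0 < 2 * Real.pi * R := by positivity
  have hin : ∀ i ∈ poleIndex α R, |(indexedPole α i).re| < M
      ∧ |(indexedPole α i).im| < 2 * Real.pi * R := by
    rintro (_ | ⟨j, k⟩) hi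
    · simpa [indexedPole] using ⟨hM, by positivity⟩
    · obtain ⟨hk0, hk⟩ := some_mem_poleIndex.1 hi
      simp only at hk
      rw [indexedPole, expPole_re, expPole_im, abs_zero]
      refine ⟨hM, ?_⟩
      rw [abs_div, abs_of_pos (hα j), div_lt_iff₀ (hα j), abs_mul,
        abs_of_pos (by positivity : 0 < 2 * Real.pi), mul_assoc (2 * Real.pi)]
      refine mul_lt_mul_of_pos_left ?_ (by positivity)
      have h1 : |(k : ℝ)| ≤ ⌊R * α j⌋₊ := by exact_mod_cast hk
      have h2 := Nat.floor_le (mul_pos hR (hα j)).le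
      have h3 := hsep j ⌊R * α j⌋₊
      -- Equality would make `R α_j` an integer, against separation.
      refine (h1.trans h2).lt_of_ne fun h => ?_
      have h4 : R * α j = ⌊R * α j⌋₊ := le_antisymm (h ▸ h1) h2
      push_cast at h3
      rw [← h4, sub_self, abs_zero] at h3
      linarith
  have h := rectIntegral_eq_sum hM hT (poleIndex α R) (indexedPole α)
    (f := fun s => expRemainder α u K s / s) (P := principalPart α u K p)
    (by
      rintro (_ | ⟨j, k⟩) hi (_ | ⟨j', k'⟩) hi' h
      · rfl
      · exact absurd h.symm (expPole_ne_zero hα _ (some_mem_poleIndex.1 hi').1)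
      · exact absurd h (expPole_ne_zero hα _ (some_mem_poleIndex.1 hi).1)
      · have h1 := (expPole_eq_iff hα).1 h
        simp only at h1
        by_cases hj : j = j'
        · subst hj
          have := mul_right_cancel₀ (hα j).ne' h1
          rw [Int.cast_inj] at this
          rw [this]
        · exact absurd h1 (hirr j' j (Ne.symm hj) k k' (some_mem_poleIndex.1 hi).1))
    hin
    (by
      rintro (_ | ⟨j, k⟩) hi z hz
      · have hz : z ≠ 0 := hz
        refine AnalyticAt.sub (AnalyticAt.mul ?_ ?_)
          (analyticAt_const.mul (analyticAt_id.inv hz))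
        · exact AnalyticAt.aeval_polynomial analyticAt_id p
        · exact analyticAt_id.zpow hz
      · exact analyticAt_const.mul (AnalyticAt.inv (by fun_prop) (sub_ne_zero.2 hz)))
    (by
      rintro (_ | ⟨j, k⟩) hi
      · refine MeromorphicAt.sub (MeromorphicAt.mul ?_ ?_)
          (analyticAt_const.meromorphicAt.mul analyticAt_id.meromorphicAt.inv)
        · exact (AnalyticAt.aeval_polynomial analyticAt_id p).meromorphicAt
        · exact analyticAt_id.meromorphicAt.zpow _
      · exact analyticAt_const.meromorphicAt.mul
          (MeromorphicAt.inv (AnalyticAt.meromorphicAt (by fun_prop))))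
    (by
      intro z hz _ him
      have hz0 : z ≠ 0 := hz none (by simp [poleIndex])
      refine analyticAt_expRemainder_div hz0 fun j hj => ?_
      obtain ⟨m, rfl⟩ := exists_expPole_of_exp_eq_one (hα j) hj
      refine hz (some ⟨j, m⟩) (some_mem_poleIndex.2 ⟨?_, ?_⟩) rfl
      · rintro rfl; exact hz0 (by simp [expPole])
      · simp only
        rw [expPole_im, abs_div, abs_of_pos (hα j), div_le_iff₀ (hα j), abs_mul,
          abs_of_pos (by positivity : 0 < 2 * Real.pi), mul_assoc (2 * Real.pi)] at him
        have h1 := le_of_mul_le_mul_left him (by positivity)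
        have h2 : ((m.natAbs : ℕ) : ℝ) ≤ R * α j := by
          rw [Nat.cast_natAbs]; exact_mod_cast h1
        have h3 := Nat.le_floor h2
        rw [Int.abs_eq_natAbs]
        omega)
    (fun i _ => meromorphicAt_expRemainder_div α u K _)
    (by
      rintro (_ | ⟨j, k⟩) hi
      · exact expRemainder_div_sub_principal_isBigO u K hp
      · exact expRemainder_div_sub_residue_isBigO hα hirr u K j (some_mem_poleIndex.1 hi).1)
  rw [h, poleIndex, Finset.sum_insertNone, Finset.sum_sigma]
  have h0 : ∀ z ∈ frame M (2 * Real.pi * R), z ≠ 0 := fun z hz =>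
    ne_of_mem_frame hz (by simpa) (by simpa using hT)
  have hnone : rectIntegral (principalPart α u K p none) M (2 * Real.pi * R)
      = 2 * Real.pi * Complex.I * (p.coeff (Fintype.card ι)
        - ∑ n ∈ latticeBox ι K, (halfStep (u - linForm α n) : ℂ)) := by
    have e := rectIntegral_inv_sub (M := M) (T := 2 * Real.pi * R) (p := 0) (by simpa)
      (by simpa using hT)
    simp only [sub_zero] at e
    unfold principalPart
    rw [rectIntegral_sub hM.le hT.le, rectIntegral_polynomial_mul_zpow hM hT,
      rectIntegral_const_mul, e]
    · ring
    · exact p.continuous.continuousOn.mul (continuousOn_id.zpow₀ _ fun z hz => Or.inl (h0 z hz))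
    · exact continuousOn_const.mul (continuousOn_id.inv₀ h0)
  have hsome : ∀ j, ∀ k ∈ (Finset.Icc (-(⌊R * α j⌋₊ : ℤ)) ⌊R * α j⌋₊).erase 0,
      rectIntegral (principalPart α u K p (some ⟨j, k⟩)) M (2 * Real.pi * R)
        = 2 * Real.pi * Complex.I * expResidue α u j k := fun j k hk => by
    have hk' : some ⟨j, k⟩ ∈ poleIndex α R := by
      rw [some_mem_poleIndex]
      simpa [abs_le] using hk
    simp only [principalPart]
    rw [rectIntegral_const_mul, rectIntegral_inv_sub (p := expPole α j k) (hin _ hk').1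
      (hin _ hk').2, mul_comm]
  rw [hnone, Finset.sum_congr rfl fun j _ => Finset.sum_congr rfl (hsome j)]
  simp_rw [sum_Icc_neg_erase_zero, ← mul_add]
  unfold residueSum
  simp only [← Finset.mul_sum]
  ring

/-- The height is tied to the width by `T = M²`. The horizontal sides then contribute `M/T = 1/M`,
and the vertical ones `(T/M) e^(-dM) = M e^(-dM)`. -/
lemma norm_rectIntegral_expRemainder_div_le [Nonempty ι] {α : ι → ℝ} (hα : ∀ j, 0 < α j) {u : ℝ}
    (hu : 0 ≤ u) {K : ℕ} (hK : ∀ j, u < K * α j) {δ : ℝ} (hδ : 0 < δ) :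
    ∃ d > 0, ∃ B C : ℝ, ∀ R ∈ separatedSet α δ, ∀ M : ℝ, 1 ≤ M → 2 * Real.pi * R = M ^ 2 →
      ‖rectIntegral (fun s => expRemainder α u K s / s) M (2 * Real.pi * R)‖
        ≤ B / M + C * (M * Real.exp (-(d * M))) := by
  obtain ⟨d, hd, hd1, hd2, hd3⟩ := exists_rate α hα hK
  obtain ⟨κ₀, hκ₀, hκ₀'⟩ := exists_pos_forall_le (Finset.univ : Finset ι)
    (fun j => 1 - Real.exp (-α j)) (fun j _ => by
      rw [sub_pos, Real.exp_lt_one_iff]; linarith [hα j])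
  -- `2δ` serves the horizontal sides, through separation, and `κ₀` serves the vertical ones.
  set κ := min (2 * δ) κ₀
  have hκ : 0 < κ := by positivity
  set C₁ : ℝ := (latticeBox ι K).card
    + Fintype.card ι * (K + κ⁻¹ + 1) ^ Fintype.card ι * κ⁻¹ with hC₁
  set C₂ : ℝ := (1 + κ⁻¹) ^ Fintype.card ι + (latticeBox ι K).card with hC₂
  have hκi : 0 < κ⁻¹ := inv_pos.2 hκ
  have hC₁0 : 0 ≤ C₁ := by positivity
  have hC₂0 : 0 ≤ C₂ := by positivity
  have hj0 : 0 ≤ jumpTerm α u K := by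
    unfold jumpTerm
    exact Finset.sum_nonneg fun n _ => by split_ifs <;> norm_num
  refine ⟨d, hd, 4 * (C₁ + C₂ + jumpTerm α u K), 4 * (C₁ + C₂), fun R hR M hM hRM => ?_⟩
  have hM0 : 0 < M := by linarith
  have hT : 0 < 2 * Real.pi * R := by rw [hRM]; positivity
  have hsep : ∀ z ∈ frame M (2 * Real.pi * R), ∀ j, κ ≤ ‖1 - Complex.exp (-(α j * z))‖ := by
    intro z hz j
    rcases hz with h | h
    · refine (min_le_left _ _).trans (two_mul_le_norm_one_sub_exp (hR j) ?_)
      rw [Complex.neg_im, abs_neg, Complex.im_ofReal_mul, abs_mul, h.2, ← abs_of_pos hT,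
        ← abs_mul]
      congr 1
      ring
    · exact (min_le_right _ _).trans ((hκ₀' j (Finset.mem_univ j)).trans
        (one_sub_exp_neg_le_norm (hα j) hM h.1))
  have hpos : ∀ z ∈ frame M (2 * Real.pi * R), 0 ≤ z.re →
      ‖expRemainder α u K z - jumpTerm α u K‖ ≤ C₁ * Real.exp (-(d * z.re)) := fun z hz h =>
    norm_expRemainder_sub_le α hα hd1 hd2 hκ h (hsep z hz)
  have hneg : ∀ z ∈ frame M (2 * Real.pi * R), z.re ≤ 0 →
      ‖expRemainder α u K z + jumpTerm α u K‖ ≤ C₂ * Real.exp (d * z.re) := fun z hz h =>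
    norm_expRemainder_add_le α hu hd1 hd3 hκ h (hsep z hz)
  have hjn : ‖(jumpTerm α u K : ℂ)‖ = jumpTerm α u K := by
    rw [Complex.norm_real, Real.norm_of_nonneg hj0]
  have hmain := norm_rectIntegral_div_le hM0 hT (H := expRemainder α u K) (θ := jumpTerm α u K)
    (B := C₁ + C₂ + jumpTerm α u K) (ε := (C₁ + C₂) * Real.exp (-(d * M)))
    (by
      unfold expRemainder
      refine ContinuousOn.sub (ContinuousOn.mul (by fun_prop) (continuousOn_finsetProd _
        fun j _ => ContinuousOn.inv₀ (by fun_prop) fun z hz =>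
          norm_pos_iff.1 (hκ.trans_le (hsep z hz j)))) (by fun_prop))
    (by
      intro z hz _
      rcases le_total 0 z.re with h | h
      · have h1 := hpos z hz h
        have h2 : Real.exp (-(d * z.re)) ≤ 1 := by
          rw [Real.exp_le_one_iff]; nlinarith
        have h3 := norm_le_norm_add_norm_sub' (expRemainder α u K z) (jumpTerm α u K)
        rw [hjn] at h3
        nlinarith
      · have h1 := hneg z hz h
        have h2 : Real.exp (d * z.re) ≤ 1 := by
          rw [Real.exp_le_one_iff]; nlinarith
        have h3 := norm_sub_le (expRemainder α u K z + jumpTerm α u K) (jumpTerm α u K)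
        rw [hjn, add_sub_cancel_right] at h3
        nlinarith)
    (by
      intro z hz h
      have := hpos z hz (by linarith)
      rw [h] at this
      refine this.trans ?_
      gcongr
      linarith)
    (by
      intro z hz h
      have := hneg z hz (by linarith)
      rw [h, mul_neg] at this
      refine this.trans ?_
      gcongr
      linarith)
  refine hmain.trans (le_of_eq ?_)
  rw [hRM]
  field_simp

/-- The residue sums converge to the lattice point count, points on the boundary being counted
with weight one half. -/
theorem tendsto_residueSum [Nonempty ι] {α : ι → ℝ} (hα : ∀ j, 0 < α j)
    (hirr : ∀ i j, i ≠ j → ∀ k m : ℤ, k ≠ 0 → (k : ℝ) * α i ≠ m * α j) {u : ℝ} (hu : 0 ≤ u)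
    {K : ℕ} (hK : ∀ j, u < K * α j) {p : Polynomial ℂ}
    (hp : (fun s : ℂ => Complex.exp (u * s) * ∏ j, (s * (1 - Complex.exp (-(α j * s)))⁻¹) - p.eval s)
      =O[𝓝[≠] 0] (fun s => s ^ (Fintype.card ι + 1)))
    {δ : ℝ} (hδ : 0 < δ) :
    Tendsto (residueSum α u) (atTop ⊓ 𝓟 (separatedSet α δ))
      (𝓝 (∑ n ∈ latticeBox ι K, (halfStep (u - linForm α n) : ℂ) - p.coeff (Fintype.card ι))) := by
  obtain ⟨d, hd, B, C, hBC⟩ := norm_rectIntegral_expRemainder_div_le hα hu hK hδ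
  have hM : Tendsto (fun R : ℝ => √(2 * Real.pi * R)) atTop atTop :=
    Real.tendsto_sqrt_atTop.comp (tendsto_id.const_mul_atTop (by positivity))
  have hlim : Tendsto (fun M : ℝ => B / M + C * (M * Real.exp (-(d * M)))) atTop (𝓝 0) := by
    have h1 : Tendsto (fun M : ℝ => B / M) atTop (𝓝 0) := tendsto_const_nhds.div_atTop tendsto_id
    have h2 : Tendsto (fun M : ℝ => M * Real.exp (-(d * M))) atTop (𝓝 0) := by
      have h3 := ((Real.tendsto_pow_mul_exp_neg_atTop_nhds_zero 1).comp
        (tendsto_id.const_mul_atTop hd)).const_mul d⁻¹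
      rw [mul_zero] at h3
      refine h3.congr fun M => ?_
      simp only [Function.comp_apply, id, pow_one]
      rw [mul_assoc, inv_mul_cancel_left₀ hd.ne']
    simpa using h1.add (h2.const_mul C)
  have hev : ∀ᶠ R in atTop ⊓ 𝓟 (separatedSet α δ),
      ‖2 * Real.pi * Complex.I * (p.coeff (Fintype.card ι) + residueSum α u R
        - ∑ n ∈ latticeBox ι K, (halfStep (u - linForm α n) : ℂ))‖
        ≤ B / √(2 * Real.pi * R) + C * (√(2 * Real.pi * R)
          * Real.exp (-(d * √(2 * Real.pi * R)))) := by
    rw [eventually_inf_principal]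
    filter_upwards [hM.eventually_ge_atTop 1, eventually_gt_atTop 0] with R h1 h2 hR
    rw [← rectIntegral_expRemainder_div (M := √(2 * Real.pi * R)) hα hirr u K hp hδ h2
      (by linarith) hR]
    exact hBC R hR _ h1 (Real.sq_sqrt (by positivity)).symm
  have h0 := squeeze_zero_norm' hev ((hlim.comp hM).mono_left inf_le_left)
  have h1 := (h0.const_mul (2 * Real.pi * Complex.I)⁻¹).add_const
    (∑ n ∈ latticeBox ι K, (halfStep (u - linForm α n) : ℂ) - p.coeff (Fintype.card ι))
  rw [mul_zero, zero_add] at h1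
  refine h1.congr fun R => ?_
  rw [inv_mul_cancel_left₀ Complex.two_pi_I_ne_zero]
  ring

end limit

/-! ### Taylor expansion at zero to third order. -/

/-- `f` agrees with the cubic polynomial with the given real coefficients up to `O(s ^ 4)`. -/
def CubicApprox (f : ℂ → ℂ) (a₀ a₁ a₂ a₃ : ℝ) : Prop :=
  (fun s : ℂ => f s - (a₀ + a₁ * s + a₂ * s ^ 2 + a₃ * s ^ 3)) =O[𝓝[≠] 0] (fun s => s ^ 4)

lemma isBigO_one_of_continuous {g : ℂ → ℂ} (hg : Continuous g) :
    g =O[𝓝[≠] 0] (fun _ => (1 : ℂ)) :=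
  ((hg.tendsto 0).mono_left nhdsWithin_le_nhds).isBigO_one ℂ

lemma pow_isBigO_pow_nhdsNE_zero {m n : ℕ} (h : m ≤ n) :
    (fun s : ℂ => s ^ n) =O[𝓝[≠] 0] (fun s => s ^ m) := by
  obtain ⟨k, rfl⟩ := Nat.exists_eq_add_of_le h
  refine ((Asymptotics.isBigO_refl (fun s : ℂ => s ^ m) _).mul
    (isBigO_one_of_continuous (continuous_pow k))).congr (fun s => (pow_add s m k).symm)
    fun s => mul_one _

lemma CubicApprox.mul {f g : ℂ → ℂ} {a₀ a₁ a₂ a₃ b₀ b₁ b₂ b₃ : ℝ}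
    (hf : CubicApprox f a₀ a₁ a₂ a₃) (hg : CubicApprox g b₀ b₁ b₂ b₃) :
    CubicApprox (fun s => f s * g s) (a₀ * b₀) (a₀ * b₁ + a₁ * b₀)
      (a₀ * b₂ + a₁ * b₁ + a₂ * b₀) (a₀ * b₃ + a₁ * b₂ + a₂ * b₁ + a₃ * b₀) := by
  unfold CubicApprox at *
  have h4 : (fun s : ℂ => s ^ 4) =O[𝓝[≠] 0] (fun _ => (1 : ℂ)) :=
    isBigO_one_of_continuous (continuous_pow 4)
  have hf1 : f =O[𝓝[≠] 0] (fun _ => (1 : ℂ)) := by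
    refine ((hf.trans h4).add (isBigO_one_of_continuous
      (g := fun s : ℂ => (a₀ + a₁ * s + a₂ * s ^ 2 + a₃ * s ^ 3)) (by fun_prop))).congr_left
      fun s => by ring
  have h1 := hf1.mul hg
  have h2 := (isBigO_one_of_continuous
    (g := fun s : ℂ => (b₀ + b₁ * s + b₂ * s ^ 2 + b₃ * s ^ 3)) (by fun_prop)).mul hf
  -- With `P`, `Q` the two cubics, `fg` differs from the truncation of `PQ` by `f(g - Q) + Q(f - P)`
  -- and the terms of `PQ` of degree four to six, collected here.
  have h3 := (isBigO_one_of_continuous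
    (g := fun s : ℂ => (a₁ * b₃ + a₂ * b₂ + a₃ * b₁ : ℂ) + (a₂ * b₃ + a₃ * b₂) * s
      + a₃ * b₃ * s ^ 2) (by fun_prop)).mul (Asymptotics.isBigO_refl (fun s : ℂ => s ^ 4) (𝓝[≠] 0))
  refine ((h1.add (h2.add h3)).congr_left fun s => ?_).congr_right fun s => one_mul _
  push_cast
  ring

lemma cubicApprox_exp (u : ℝ) :
    CubicApprox (fun s => Complex.exp (u * s)) 1 u (u ^ 2 / 2) (u ^ 3 / 6) := by
  unfold CubicApprox
  have h1 := Complex.exp_sub_sum_range_isBigO_pow 4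
  have h2 : Tendsto (fun s : ℂ => (u : ℂ) * s) (𝓝[≠] 0) (𝓝 0) := by
    have : Continuous fun s : ℂ => (u : ℂ) * s := by fun_prop
    simpa using (this.tendsto 0).mono_left nhdsWithin_le_nhds
  refine ((h1.comp_tendsto h2).congr_left fun s => ?_).trans ?_
  · simp only [Function.comp_apply, Finset.sum_range_succ, Finset.sum_range_zero,
      Nat.factorial]
    push_cast
    ring
  · refine ((Asymptotics.isBigO_refl (fun s : ℂ => s ^ 4) _).const_mul_left ((u : ℂ) ^ 4)).congr_left
      fun s => ?_
    simp [mul_pow]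

/-- The coefficients are those of the Bernoulli generating function, and the last one vanishes since
`B₃ = 0`. Clearing the denominator, `s - (1/a + s/2 + as²/12)(1 - e^(-as))` is `O(s⁵)`, and `1/(1 -
e^(-as))` is `O(1/s)`. -/
lemma cubicApprox_inv_one_sub_exp {a : ℝ} (ha : 0 < a) :
    CubicApprox (fun s => s * (1 - Complex.exp (-(a * s)))⁻¹) (1 / a) (1 / 2) (a / 12) 0 := by
  unfold CubicApprox
  have ha0 : (a : ℂ) ≠ 0 := by exact_mod_cast ha.ne'
  have hder : HasDerivAt (fun s : ℂ => 1 - Complex.exp (-((a : ℂ) * s))) a 0 := by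
    have h1 : HasDerivAt (fun s : ℂ => -((a : ℂ) * s)) (-(a : ℂ)) 0 := by
      simpa using (hasDerivAt_id (0 : ℂ)).const_mul (-(a : ℂ))
    simpa using h1.cexp.const_sub 1
  have hinv : (fun s : ℂ => (1 - Complex.exp (-((a : ℂ) * s)))⁻¹) =O[𝓝[≠] 0] (fun s => s⁻¹) := by
    have h1 := div_sub_residue_isBigO_one (E := fun _ => 1) (p := 0) analyticAt_const
      (by fun_prop) (by simp) hder ha0
    have h2 : (fun _ => (1 : ℂ)) =O[𝓝[≠] 0] (fun s : ℂ => s⁻¹) := by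
      refine ((isBigO_one_of_continuous continuous_id).mul
        (Asymptotics.isBigO_refl (fun s : ℂ => s⁻¹) _)).congr' ?_ (Eventually.of_forall
          fun s => one_mul _)
      filter_upwards [self_mem_nhdsWithin] with s hs
      exact mul_inv_cancel₀ hs
    refine ((h1.trans h2).add ((Asymptotics.isBigO_refl (fun s : ℂ => s⁻¹) _).const_mul_left
      (1 / (a : ℂ)))).congr_left fun s => ?_
    simp
  have hexp : (fun s : ℂ => (1 - Complex.exp (-((a : ℂ) * s)))
      - (a * s - a ^ 2 * s ^ 2 / 2 + a ^ 3 * s ^ 3 / 6 - a ^ 4 * s ^ 4 / 24))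
      =O[𝓝[≠] 0] (fun s => s ^ 5) := by
    have h1 := Complex.exp_sub_sum_range_isBigO_pow 5
    have h2 : Tendsto (fun s : ℂ => -((a : ℂ) * s)) (𝓝[≠] 0) (𝓝 0) := by
      have : Continuous fun s : ℂ => -((a : ℂ) * s) := by fun_prop
      simpa using (this.tendsto 0).mono_left nhdsWithin_le_nhds
    refine ((h1.comp_tendsto h2).neg_left.congr_left fun s => ?_).trans ?_
    · simp only [Function.comp_apply, Finset.sum_range_succ, Finset.sum_range_zero,
        Nat.factorial]
      push_cast
      ring
    · refine ((Asymptotics.isBigO_refl (fun s : ℂ => s ^ 5) _).const_mul_left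
        (-(a : ℂ) ^ 5)).congr_left fun s => ?_
      simp only [Function.comp_apply]
      ring
  have hnum : (fun s : ℂ => s - ((1 / a : ℂ) + 1 / 2 * s + a / 12 * s ^ 2)
      * (1 - Complex.exp (-((a : ℂ) * s)))) =O[𝓝[≠] 0] (fun s => s ^ 5) := by
    have h1 := (isBigO_one_of_continuous
      (g := fun s : ℂ => (1 / a : ℂ) + 1 / 2 * s + a / 12 * s ^ 2) (by fun_prop)).mul hexp
    -- After inserting the quartic Taylor polynomial of `1 - e^(-as)`, everything below degree five
    -- cancels. These are the coefficients of `s⁵` and `s⁶`.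
    have h2 := (isBigO_one_of_continuous
      (g := fun s : ℂ => (a : ℂ) ^ 4 / 144 + (a : ℂ) ^ 5 / 288 * s) (by fun_prop)).mul
        (Asymptotics.isBigO_refl (fun s : ℂ => s ^ 5) (𝓝[≠] 0))
    refine ((h2.sub h1).congr_left fun s => ?_).congr_right fun s => one_mul _
    field_simp
    ring
  refine (hnum.mul hinv).congr' ?_ ?_
  · have hev : ∀ᶠ s : ℂ in 𝓝[≠] 0, 1 - Complex.exp (-((a : ℂ) * s)) ≠ 0 := by
      simpa using hder.eventually_ne (c := 0) ha0
    filter_upwards [hev] with s hs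
    rw [sub_mul, mul_assoc, mul_inv_cancel₀ hs]
    push_cast
    ring
  · filter_upwards [self_mem_nhdsWithin] with s hs
    have hs : s ≠ 0 := hs
    field_simp

/-- The cubic polynomial with the given coefficients. -/
noncomputable def cubicPoly (c₀ c₁ c₂ c₃ : ℝ) : Polynomial ℂ :=
  Polynomial.C (c₀ : ℂ) + Polynomial.C (c₁ : ℂ) * Polynomial.X
    + Polynomial.C (c₂ : ℂ) * Polynomial.X ^ 2 + Polynomial.C (c₃ : ℂ) * Polynomial.X ^ 3

lemma CubicApprox.isBigO {f : ℂ → ℂ} {a₀ a₁ a₂ a₃ : ℝ} (h : CubicApprox f a₀ a₁ a₂ a₃) {m : ℕ}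
    (hm : m ≤ 4) :
    (fun s => f s - (cubicPoly a₀ a₁ a₂ a₃).eval s) =O[𝓝[≠] 0] (fun s => s ^ m) := by
  refine (Asymptotics.IsBigO.trans ?_ (pow_isBigO_pow_nhdsNE_zero hm))
  refine Asymptotics.IsBigO.congr_left h fun s => ?_
  simp [cubicPoly]

/-! ### Residues in terms of cotangents. -/

/-- The value of `cot (π k α_i / α_j)`. -/
noncomputable def cotRatio {ι : Type*} (α : ι → ℝ) (j i : ι) (k : ℤ) : ℝ :=
  Real.cos (Real.pi * k * α i / α j) / Real.sin (Real.pi * k * α i / α j)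

lemma cotRatio_neg {ι : Type*} (α : ι → ℝ) (j i : ι) (k : ℤ) :
    cotRatio α j i (-k) = -cotRatio α j i k := by
  unfold cotRatio
  have : Real.pi * ((-k : ℤ) : ℝ) * α i / α j = -(Real.pi * k * α i / α j) := by
    push_cast; ring
  rw [this, Real.cos_neg, Real.sin_neg, div_neg]

lemma sin_ratio_ne_zero {ι : Type*} {α : ι → ℝ} (hα : ∀ j, 0 < α j)
    (hirr : ∀ i j, i ≠ j → ∀ k m : ℤ, k ≠ 0 → (k : ℝ) * α i ≠ m * α j) {i j : ι} (hij : i ≠ j)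
    {k : ℤ} (hk : k ≠ 0) : Real.sin (Real.pi * k * α i / α j) ≠ 0 := by
  intro h
  obtain ⟨m, hm⟩ := Real.sin_eq_zero_iff.1 h
  refine hirr i j hij k m hk ?_
  have := (hα j).ne'
  rw [eq_div_iff this] at hm
  have hpi := Real.pi_pos.ne'
  apply mul_left_cancel₀ hpi
  linear_combination -hm

/-- From `1 - e^(-2iθ) = 2i sin θ · e^(-iθ)`. This is where the cotangents come from. -/
lemma inv_one_sub_exp_neg_mul_I {θ : ℝ} (h : Real.sin θ ≠ 0) :
    (1 - Complex.exp (-(2 * θ * Complex.I)))⁻¹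
      = 1 / 2 - Complex.I * ((Real.cos θ / Real.sin θ / 2 : ℝ) : ℂ) := by
  have hs : (Real.sin θ : ℂ) ≠ 0 := by exact_mod_cast h
  have h1 : Complex.exp (-(2 * θ * Complex.I))
      = (Real.cos θ - Real.sin θ * Complex.I) ^ 2 := by
    rw [Complex.ofReal_cos, Complex.ofReal_sin]
    have h2 : Complex.cos θ - Complex.sin θ * Complex.I = Complex.exp (-θ * Complex.I) := by
      rw [Complex.exp_mul_I, Complex.cos_neg, Complex.sin_neg]; ring
    rw [h2, ← Complex.exp_nat_mul]
    congr 1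
    push_cast
    ring
  have h3 : (Real.sin θ : ℂ) ^ 2 + (Real.cos θ : ℂ) ^ 2 = 1 := by
    exact_mod_cast Real.sin_sq_add_cos_sq θ
  have hI := Complex.I_sq
  rw [h1, Complex.ofReal_div, Complex.ofReal_div]
  generalize ((Real.sin θ : ℝ) : ℂ) = S at *
  generalize ((Real.cos θ : ℝ) : ℂ) = C at *
  have h4 : 1 - (C - S * Complex.I) ^ 2 = 2 * S * (S + C * Complex.I) := by
    linear_combination -h3 - S ^ 2 * hI
  have h5 : 1 / 2 - Complex.I * (C / S / ((2 : ℝ) : ℂ)) = (S - Complex.I * C) / (2 * S) := by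
    push_cast
    field_simp
  refine inv_eq_of_mul_eq_one_right ?_
  rw [h4, h5]
  field_simp
  linear_combination h3 - C ^ 2 * hI

lemma inv_one_sub_exp_expPole {ι : Type*} {α : ι → ℝ} (hα : ∀ j, 0 < α j)
    (hirr : ∀ i j, i ≠ j → ∀ k m : ℤ, k ≠ 0 → (k : ℝ) * α i ≠ m * α j) {i j : ι} (hij : i ≠ j)
    {k : ℤ} (hk : k ≠ 0) :
    (1 - Complex.exp (-(α i * expPole α j k)))⁻¹
      = 1 / 2 - Complex.I * (cotRatio α j i k / 2 : ℝ) := by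
  rw [cotRatio, ← inv_one_sub_exp_neg_mul_I (sin_ratio_ne_zero hα hirr hij hk), expPole]
  congr 4
  push_cast
  ring

/-- The two summands are complex conjugates, so their sum is twice the real part of the first. -/
lemma exp_div_mul_add_neg {φ A X Y : ℝ} {k : ℤ} (hA : A ≠ 0) (hk : k ≠ 0) :
    Complex.exp (φ * Complex.I) / (2 * Real.pi * Complex.I * k / A) * (X - Complex.I * Y) / A
      + Complex.exp (-(φ * Complex.I)) / (2 * Real.pi * Complex.I * (-k : ℤ) / A)
        * (X + Complex.I * Y) / A
      = (((Real.sin φ * X - Real.cos φ * Y) / (Real.pi * k) : ℝ) : ℂ) := by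
  have hA' : (A : ℂ) ≠ 0 := by exact_mod_cast hA
  have hk' : (k : ℂ) ≠ 0 := by exact_mod_cast hk
  have hpi : (Real.pi : ℂ) ≠ 0 := by exact_mod_cast Real.pi_pos.ne'
  have hI := Complex.I_ne_zero
  rw [← neg_mul, Complex.exp_mul_I, Complex.exp_mul_I, Complex.cos_neg, Complex.sin_neg]
  push_cast
  field_simp
  ring

section residue

variable {ι : Type*} [Fintype ι] [DecidableEq ι]

lemma expResidue_add_neg {α : ι → ℝ} (hα : ∀ j, 0 < α j) (u : ℝ) (j : ι) {k : ℤ} (hk : k ≠ 0)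
    {X Y : ℝ}
    (h1 : ∏ i ∈ Finset.univ.erase j, (1 - Complex.exp (-(α i * expPole α j k)))⁻¹
      = X - Complex.I * Y)
    (h2 : ∏ i ∈ Finset.univ.erase j, (1 - Complex.exp (-(α i * expPole α j (-k))))⁻¹
      = X + Complex.I * Y) :
    expResidue α u j k + expResidue α u j (-k)
      = (((Real.sin (2 * Real.pi * k * (u / α j)) * X - Real.cos (2 * Real.pi * k * (u / α j)) * Y)
        / (Real.pi * k) : ℝ) : ℂ) := by
  have e1 : (u : ℂ) * expPole α j k
      = ((2 * Real.pi * k * (u / α j) : ℝ) : ℂ) * Complex.I := by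
    rw [expPole]; push_cast; ring
  have e2 : (u : ℂ) * expPole α j (-k)
      = -(((2 * Real.pi * k * (u / α j) : ℝ) : ℂ) * Complex.I) := by
    rw [expPole]; push_cast; ring
  rw [← exp_div_mul_add_neg (hα j).ne' hk, expResidue, expResidue, h1, h2, e1, e2, expPole, expPole]

end residue

/-! ### Residue sums as trigonometric sums for one, two and three bases. -/

/-- The sum over `1 ≤ k ≤ ⌊R log a⌋` of `sin (2 π k log x / log a) / k`. -/
noncomputable def sinSum (a : ℕ) (x R : ℝ) : ℝ :=
  ∑ k ∈ Finset.Icc 1 ⌊R * Real.log a⌋₊,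
    Real.sin (2 * Real.pi * k * (Real.log x / Real.log a)) / k

section residueSums

variable {ι : Type*} [Fintype ι] [DecidableEq ι] {α : ι → ℝ}

lemma sum_expResidue_of_erase_eq_empty (hα : ∀ j, 0 < α j) {j : ι} (hj : Finset.univ.erase j = ∅)
    {a : ℕ} (ha : α j = Real.log a) (x R : ℝ) :
    ∑ k ∈ Finset.Icc 1 ⌊R * α j⌋₊,
      (expResidue α (Real.log x) j k + expResidue α (Real.log x) j (-k))
      = ((1 / Real.pi * sinSum a x R : ℝ) : ℂ) := by
  rw [sinSum, Finset.mul_sum, Complex.ofReal_sum, ha]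
  refine Finset.sum_congr rfl fun k hk => ?_
  have hk0 : (k : ℤ) ≠ 0 := by have := (Finset.mem_Icc.1 hk).1; omega
  rw [expResidue_add_neg hα _ j hk0 (X := 1) (Y := 0) (by simp [hj]) (by simp [hj]), ha]
  congr 1
  push_cast
  have := Real.pi_pos.ne'
  field_simp
  ring

lemma sum_expResidue_of_erase_eq_singleton (hα : ∀ j, 0 < α j)
    (hirr : ∀ i j, i ≠ j → ∀ k m : ℤ, k ≠ 0 → (k : ℝ) * α i ≠ m * α j)
    {j i : ι} (hj : Finset.univ.erase j = {i}) (hij : i ≠ j)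
    {a b : ℕ} (ha : α j = Real.log a) (hb : α i = Real.log b) (x R : ℝ) :
    ∑ k ∈ Finset.Icc 1 ⌊R * α j⌋₊,
      (expResidue α (Real.log x) j k + expResidue α (Real.log x) j (-k))
      = ((1 / (2 * Real.pi) * (sinSum a x R - cotCosSum a b x R) : ℝ) : ℂ) := by
  rw [sinSum, cotCosSum, ← Finset.sum_sub_distrib, Finset.mul_sum, Complex.ofReal_sum, ha]
  refine Finset.sum_congr rfl fun k hk => ?_
  have hk0 : (k : ℤ) ≠ 0 := by have := (Finset.mem_Icc.1 hk).1; omega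
  have hkr : (k : ℝ) ≠ 0 := by exact_mod_cast hk0
  have hs := sin_ratio_ne_zero hα hirr hij hk0
  rw [expResidue_add_neg hα _ j hk0 (X := 1 / 2) (Y := cotRatio α j i k / 2)
    (by rw [hj, Finset.prod_singleton, inv_one_sub_exp_expPole hα hirr hij hk0]; push_cast; ring)
    (by
      rw [hj, Finset.prod_singleton, inv_one_sub_exp_expPole hα hirr hij (neg_ne_zero.2 hk0),
        cotRatio_neg]
      push_cast; ring)]
  congr 1
  rw [cotRatio]
  rw [ha, hb] at *
  have := Real.pi_pos.ne'
  rw [Int.cast_natCast] at *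
  field_simp

/-- With `C`, `C'` the two cotangents, `(1 - iC)(1 - iC')/4` has real part `(1 - CC')/4`, which goes
with the sine, and imaginary part `-(C + C')/4`, which goes with the cosine. This gives the four
sums. -/
lemma sum_expResidue_of_erase_eq_pair (hα : ∀ j, 0 < α j)
    (hirr : ∀ i j, i ≠ j → ∀ k m : ℤ, k ≠ 0 → (k : ℝ) * α i ≠ m * α j)
    {j i l : ι} (hj : Finset.univ.erase j = {i, l}) (hij : i ≠ j) (hlj : l ≠ j) (hil : i ≠ l)
    {a b c : ℕ} (ha : α j = Real.log a) (hb : α i = Real.log b) (hc : α l = Real.log c) (x R : ℝ) :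
    ∑ k ∈ Finset.Icc 1 ⌊R * α j⌋₊,
      (expResidue α (Real.log x) j k + expResidue α (Real.log x) j (-k))
      = ((1 / (4 * Real.pi) * (sinSum a x R - cotCotSinSum a b c x R - cotCosSum a b x R
          - cotCosSum a c x R) : ℝ) : ℂ) := by
  rw [sinSum, cotCosSum, cotCosSum, cotCotSinSum, ← Finset.sum_sub_distrib,
    ← Finset.sum_sub_distrib, ← Finset.sum_sub_distrib, Finset.mul_sum, Complex.ofReal_sum, ha]
  refine Finset.sum_congr rfl fun k hk => ?_
  have hk0 : (k : ℤ) ≠ 0 := by have := (Finset.mem_Icc.1 hk).1; omega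
  have hkr : (k : ℝ) ≠ 0 := by exact_mod_cast hk0
  have hs := sin_ratio_ne_zero hα hirr hij hk0
  have hs' := sin_ratio_ne_zero hα hirr hlj hk0
  rw [expResidue_add_neg hα _ j hk0
    (X := (1 - cotRatio α j i k * cotRatio α j l k) / 4)
    (Y := (cotRatio α j i k + cotRatio α j l k) / 4)
    (by
      rw [hj, Finset.prod_pair hil, inv_one_sub_exp_expPole hα hirr hij hk0,
        inv_one_sub_exp_expPole hα hirr hlj hk0]
      push_cast
      linear_combination (cotRatio α j i k * cotRatio α j l k / 4 : ℂ) * Complex.I_sq)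
    (by
      rw [hj, Finset.prod_pair hil, inv_one_sub_exp_expPole hα hirr hij (neg_ne_zero.2 hk0),
        inv_one_sub_exp_expPole hα hirr hlj (neg_ne_zero.2 hk0), cotRatio_neg, cotRatio_neg]
      push_cast
      linear_combination (cotRatio α j i k * cotRatio α j l k / 4 : ℂ) * Complex.I_sq)]
  congr 1
  rw [cotRatio, cotRatio]
  rw [ha, hb] at hs
  rw [ha, hc] at hs'
  rw [ha, hb, hc]
  have := Real.pi_pos.ne'
  rw [Int.cast_natCast] at *
  field_simp
  ring

end residueSums

lemma residueSum_one {a : ℕ} (ha : 0 < Real.log a) (x R : ℝ) :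
    residueSum ![Real.log a] (Real.log x) R = ((1 / Real.pi * sinSum a x R : ℝ) : ℂ) := by
  have hα : ∀ j, 0 < ![Real.log a] j := by intro j; fin_cases j; exact ha
  rw [residueSum, Fin.sum_univ_one, sum_expResidue_of_erase_eq_empty hα (j := 0) (by decide) rfl]

lemma residueSum_two {a b : ℕ} (hα : ∀ j, 0 < ![Real.log a, Real.log b] j)
    (hirr : ∀ i j, i ≠ j → ∀ k m : ℤ, k ≠ 0 →
      (k : ℝ) * ![Real.log a, Real.log b] i ≠ m * ![Real.log a, Real.log b] j) (x R : ℝ) :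
    residueSum ![Real.log a, Real.log b] (Real.log x) R
      = ((1 / (2 * Real.pi) * (sinSum a x R + sinSum b x R
        - (cotCosSum a b x R + cotCosSum b a x R)) : ℝ) : ℂ) := by
  rw [residueSum, Fin.sum_univ_two,
    sum_expResidue_of_erase_eq_singleton hα hirr (j := 0) (i := 1) (by decide) (by decide) rfl rfl,
    sum_expResidue_of_erase_eq_singleton hα hirr (j := 1) (i := 0) (by decide) (by decide) rfl rfl,
    ← Complex.ofReal_add]
  congr 1
  ring

lemma residueSum_three {a b c : ℕ} (hα : ∀ j, 0 < ![Real.log a, Real.log b, Real.log c] j)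
    (hirr : ∀ i j, i ≠ j → ∀ k m : ℤ, k ≠ 0 →
      (k : ℝ) * ![Real.log a, Real.log b, Real.log c] i
        ≠ m * ![Real.log a, Real.log b, Real.log c] j) (x R : ℝ) :
    residueSum ![Real.log a, Real.log b, Real.log c] (Real.log x) R
      = ((1 / (4 * Real.pi) * (sinSum a x R + sinSum b x R + sinSum c x R
        - (cotCosSum a b x R + cotCosSum b a x R) - (cotCosSum b c x R + cotCosSum c b x R)
        - (cotCosSum c a x R + cotCosSum a c x R)
        - (cotCotSinSum a b c x R + cotCotSinSum b a c x R + cotCotSinSum c a b x R)) : ℝ) : ℂ) := by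
  rw [residueSum, Fin.sum_univ_three,
    sum_expResidue_of_erase_eq_pair hα hirr (j := 0) (i := 1) (l := 2) (by decide) (by decide)
      (by decide) (by decide) rfl rfl rfl,
    sum_expResidue_of_erase_eq_pair hα hirr (j := 1) (i := 0) (l := 2) (by decide) (by decide)
      (by decide) (by decide) rfl rfl rfl,
    sum_expResidue_of_erase_eq_pair hα hirr (j := 2) (i := 0) (l := 1) (by decide) (by decide)
      (by decide) (by decide) rfl rfl rfl,
    ← Complex.ofReal_add, ← Complex.ofReal_add]
  congr 1
  ring

/-! ### Real limits for one and two bases. -/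

lemma cubicPoly_coeff_one (c₀ c₁ c₂ c₃ : ℝ) : (cubicPoly c₀ c₁ c₂ c₃).coeff 1 = c₁ := by
  simp [cubicPoly, Polynomial.coeff_C, Polynomial.coeff_X_pow]

lemma cubicPoly_coeff_two (c₀ c₁ c₂ c₃ : ℝ) : (cubicPoly c₀ c₁ c₂ c₃).coeff 2 = c₂ := by
  simp [cubicPoly, Polynomial.coeff_X_pow]

lemma cubicPoly_coeff_three (c₀ c₁ c₂ c₃ : ℝ) : (cubicPoly c₀ c₁ c₂ c₃).coeff 3 = c₃ := by
  simp [cubicPoly, Polynomial.coeff_X_pow]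

lemma tendsto_of_tendsto_ofReal {A : Type*} {F : Filter A} {f : A → ℝ} {v : ℝ}
    (h : Tendsto (fun r => (f r : ℂ)) F (𝓝 (v : ℂ))) : Tendsto f F (𝓝 v) := by
  exact (Complex.continuous_re.tendsto _).comp h

/-- The lattice point count, points on the boundary being counted with weight one half. -/
noncomputable def halfCount {ι : Type*} [Fintype ι] [DecidableEq ι] (α : ι → ℝ) (u : ℝ) (K : ℕ) :
    ℝ :=
  ∑ n ∈ latticeBox ι K, halfStep (u - linForm α n)

lemma tendsto_of_cubicApprox {ι : Type*} [Fintype ι] [DecidableEq ι] [Nonempty ι] {α : ι → ℝ}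
    (hα : ∀ j, 0 < α j)
    (hirr : ∀ i j, i ≠ j → ∀ k m : ℤ, k ≠ 0 → (k : ℝ) * α i ≠ m * α j) {u : ℝ} (hu : 0 ≤ u)
    {K : ℕ} (hK : ∀ j, u < K * α j) (hcard : Fintype.card ι + 1 ≤ 4) {c₀ c₁ c₂ c₃ v : ℝ}
    (hc : CubicApprox (fun s : ℂ => Complex.exp (u * s)
      * ∏ j, (s * (1 - Complex.exp (-(α j * s)))⁻¹)) c₀ c₁ c₂ c₃)
    (hv : (cubicPoly c₀ c₁ c₂ c₃).coeff (Fintype.card ι) = v)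
    {g : ℝ → ℝ} (hg : ∀ R, residueSum α u R = (g R : ℂ)) {δ : ℝ} (hδ : 0 < δ) :
    Tendsto g (atTop ⊓ 𝓟 (separatedSet α δ)) (𝓝 (halfCount α u K - v)) := by
  have h := tendsto_residueSum hα hirr hu hK (hc.isBigO hcard) hδ
  rw [hv] at h
  refine tendsto_of_tendsto_ofReal (h.congr hg |>.trans (le_of_eq ?_))
  rw [halfCount]
  push_cast
  rfl

lemma exists_forall_lt_mul {ι : Type*} [Fintype ι] {α : ι → ℝ} (hα : ∀ j, 0 < α j) (u : ℝ) :
    ∃ K : ℕ, ∀ j, u < K * α j := by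
  obtain ⟨d, hd, h⟩ := exists_pos_forall_le Finset.univ α fun j _ => hα j
  obtain ⟨K, hK⟩ := exists_nat_gt (u / d)
  refine ⟨K, fun j => ?_⟩
  rw [div_lt_iff₀ hd] at hK
  exact hK.trans_le (mul_le_mul_of_nonneg_left (h j (Finset.mem_univ j)) (Nat.cast_nonneg _))

lemma halfStep_sub (u l : ℝ) :
    halfStep (u - l) = (if l ≤ u then 1 else 0) - (if u = l then 1 / 2 else 0) := by
  unfold halfStep
  rcases lt_trichotomy u l with h | h | h
  · simp [h, h.not_ge, h.ne]
  · subst h; norm_num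
  · have h1 : u - l ≠ 0 := sub_ne_zero.2 h.ne'
    simp [h.le, h.not_gt, h.ne', h1]

/-- With `y = u/A` the count is `⌊y⌋ + 1`, less one half when `y` is an integer. In both cases this
is `y + 1/2 - B₁^*({y})`. -/
lemma halfCount_one {A u : ℝ} (hA : 0 < A) (hu : 0 ≤ u) {K : ℕ} (hK : u < K * A) :
    halfCount ![A] u K = u / A + 1 / 2 - bernoulliOneStar (u / A) := by
  have h1 : halfCount ![A] u K = ∑ m ∈ Finset.range K, halfStep (u - m * A) := by
    unfold halfCount latticeBox
    refine Finset.sum_nbij' (fun n => n 0) (fun m _ => m) ?_ ?_ ?_ ?_ ?_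
    · intro n hn; simpa using Fintype.mem_piFinset.1 hn 0
    · intro m hm; exact Fintype.mem_piFinset.2 fun _ => hm
    · intro n _; ext j; fin_cases j; rfl
    · intro m _; rfl
    · intro n _; simp [linForm]
  have hy : 0 ≤ u / A := div_nonneg hu hA.le
  have hfl : ⌊u / A⌋₊ < K := by
    rw [Nat.floor_lt hy, div_lt_iff₀ hA]; exact hK
  have h2 : ∑ m ∈ Finset.range K, (if (m : ℝ) * A ≤ u then (1 : ℝ) else 0) = ⌊u / A⌋₊ + 1 := by
    rw [← Finset.sum_filter, Finset.sum_const, nsmul_eq_mul, mul_one]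
    have : (Finset.range K).filter (fun m : ℕ => (m : ℝ) * A ≤ u) = Finset.range (⌊u / A⌋₊ + 1) := by
      ext m
      rw [Finset.mem_filter, Finset.mem_range, Finset.mem_range, ← le_div_iff₀ hA,
        ← Nat.le_floor_iff hy]
      omega
    rw [this, Finset.card_range]
    push_cast
    rfl
  rw [h1]
  simp_rw [halfStep_sub]
  rw [Finset.sum_sub_distrib, h2]
  have hfract : Int.fract (u / A) = u / A - ⌊u / A⌋₊ := by
    rw [Int.fract, natCast_floor_eq_intCast_floor hy]
  unfold bernoulliOneStar
  split_ifs with h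
  · rw [Finset.sum_eq_single ⌊u / A⌋₊]
    · rw [hfract, sub_eq_zero] at h
      rw [if_pos ((div_eq_iff hA.ne').1 h), ← h]
      ring
    · intro m _ hm
      rw [if_neg]
      intro hm'
      apply hm
      rw [hm', mul_div_cancel_right₀ _ hA.ne', Nat.floor_natCast]
    · intro h'; exact absurd (Finset.mem_range.2 hfl) h'
  · rw [Finset.sum_eq_zero]
    · rw [hfract]; ring
    · intro m _
      rw [if_neg]
      intro hm
      apply h
      rw [hm, mul_div_cancel_right₀ _ hA.ne', Int.fract_natCast]

/-- The Fourier series of the sawtooth, obtained as the one-base case of the limit theorem: the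
linear terms of the count and of the Taylor coefficient cancel. -/
lemma tendsto_sinSum {a : ℕ} (ha : 0 < Real.log a) {x : ℝ} (hx : 1 ≤ x) {δ : ℝ} (hδ : 0 < δ) :
    Tendsto (sinSum a x) (atTop ⊓ 𝓟 (separatedSet ![Real.log a] δ))
      (𝓝 (-(Real.pi * bernoulliOneStar (Real.log x / Real.log a)))) := by
  have hα : ∀ j, 0 < ![Real.log a] j := by intro j; fin_cases j; exact ha
  obtain ⟨K, hK⟩ := exists_forall_lt_mul hα (Real.log x)
  have hu := Real.log_nonneg hx
  have h := tendsto_of_cubicApprox hα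
    (fun i j hij => absurd (Subsingleton.elim i j) hij) hu hK (by decide)
    (v := Real.log x / Real.log a + 1 / 2)
    (by
      simp_rw [Fin.prod_univ_one]
      exact (cubicApprox_exp _).mul (cubicApprox_inv_one_sub_exp ha))
    ((cubicPoly_coeff_one _ _ _ _).trans (by push_cast; ring))
    (residueSum_one ha x) hδ
  have h' := h.const_mul Real.pi
  have hpi := Real.pi_pos.ne'
  rw [halfCount_one ha hu (hK 0)] at h'
  refine (h'.congr fun R => ?_).trans (le_of_eq ?_)
  · field_simp
  · congr 1; ring

/-- In the two-base limit the sine sums are already known to converge, so the paired cotangent sums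
do too. The limit is written through the half-weighted count and is therefore the same for every
`δ`. -/
lemma exists_tendsto_cotCosSum {a b : ℕ} (hα : ∀ j, 0 < ![Real.log a, Real.log b] j)
    (hirr : ∀ i j, i ≠ j → ∀ k m : ℤ, k ≠ 0 →
      (k : ℝ) * ![Real.log a, Real.log b] i ≠ m * ![Real.log a, Real.log b] j)
    {x : ℝ} (hx : 1 ≤ x) :
    ∃ P : ℝ, ∀ δ > 0, Tendsto (fun R => cotCosSum a b x R + cotCosSum b a x R)
      (atTop ⊓ 𝓟 (separatedSet ![Real.log a, Real.log b] δ)) (𝓝 P) := by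
  obtain ⟨K, hK⟩ := exists_forall_lt_mul hα (Real.log x)
  have hu := Real.log_nonneg hx
  obtain ⟨c₀, c₁, c₂, c₃, hc⟩ : ∃ c₀ c₁ c₂ c₃ : ℝ,
      CubicApprox (fun s : ℂ => Complex.exp (Real.log x * s)
        * ∏ j, (s * (1 - Complex.exp (-(![Real.log a, Real.log b] j * s)))⁻¹)) c₀ c₁ c₂ c₃ :=
    ⟨_, _, _, _, by
      simp_rw [Fin.prod_univ_two]
      exact (cubicApprox_exp _).mul ((cubicApprox_inv_one_sub_exp (hα 0)).mul
        (cubicApprox_inv_one_sub_exp (hα 1)))⟩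
  refine ⟨-(Real.pi * bernoulliOneStar (Real.log x / Real.log a))
    + -(Real.pi * bernoulliOneStar (Real.log x / Real.log b))
    - 2 * Real.pi * (halfCount ![Real.log a, Real.log b] (Real.log x) K - c₂), fun δ hδ => ?_⟩
  have h := tendsto_of_cubicApprox hα hirr hu hK (by decide) hc (cubicPoly_coeff_two c₀ c₁ c₂ c₃)
    (residueSum_two hα hirr x) hδ
  have hle : ∀ i : Fin 2, atTop ⊓ 𝓟 (separatedSet ![Real.log a, Real.log b] δ)
      ≤ atTop ⊓ 𝓟 (separatedSet ![![Real.log a, Real.log b] i] δ) := fun i => by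
    refine inf_le_inf_left _ (principal_mono.2 fun R hR l m => ?_)
    fin_cases l
    exact hR i m
  have hsa := (tendsto_sinSum (hα 0) hx hδ).mono_left (hle 0)
  have hsb := (tendsto_sinSum (hα 1) hx hδ).mono_left (hle 1)
  refine ((hsa.add hsb).sub (h.const_mul (2 * Real.pi))).congr fun R => ?_
  have hpi := Real.pi_pos.ne'
  field_simp
  ring

/-! ### Existence of separated values of `R`. -/

/-- The numbers separated from the integers after scaling by three positive reals are unbounded. -/
lemma exists_separatedSet_neBot {α : Fin 3 → ℝ} (hα : ∀ j, 0 < α j) :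
    ∃ δ > 0, (atTop ⊓ 𝓟 (separatedSet α δ)).NeBot := by
  obtain ⟨d, hd, hd'⟩ := exists_pos_forall_le Finset.univ α fun j _ => hα j
  set A : ℝ := ∑ j, α j with hA
  have hAj : ∀ j, α j ≤ A := fun j =>
    Finset.single_le_sum (f := α) (fun i _ => (hα i).le) (Finset.mem_univ j)
  have hA0 : 0 < A := (hα 0).trans_le (hAj 0)
  -- The step is chosen so that three steps move every `R α_j` by at most `1/2`, while one step
  -- moves it by at least `dη`, three times the separation sought.
  set η : ℝ := 1 / (6 * A) with hη
  have hη0 : 0 < η := by positivity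
  have hηA : ∀ j, α j * η ≤ 1 / 6 := fun j => by
    have : α j * η ≤ A * η := mul_le_mul_of_nonneg_right (hAj j) hη0.le
    have h2 : A * η = 1 / 6 := by rw [hη]; field_simp
    linarith
  have hdη : ∀ j, d * η ≤ α j * η := fun j =>
    mul_le_mul_of_nonneg_right (hd' j (Finset.mem_univ j)) hη0.le
  have hdη0 : 0 < d * η := mul_pos hd hη0
  refine ⟨d * η / 3, by positivity, ?_⟩
  rw [← frequently_mem_iff_neBot, frequently_atTop]
  intro X
  by_contra! hcon
  -- Pigeonhole: if four equally spaced points were all bad, two would fail at the same `j`. The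
  -- nearby integers would then differ by more than `0` and less than `1`.
  have hbad : ∀ i : Fin 4, ∃ j : Fin 3, ∃ m : ℤ,
      |(X + i * η) * α j - m| < d * η / 3 := by
    intro i
    have h1 := hcon (X + i * η) (le_add_of_nonneg_right (by positivity))
    simpa [separatedSet] using h1
  choose f m hm using hbad
  obtain ⟨i, i', hne, hf⟩ := Fintype.exists_ne_map_eq_of_card_lt f (by simp)
  wlog hlt : i < i' generalizing i i'
  · exact this i' i hne.symm hf.symm (lt_of_le_of_ne (not_lt.1 hlt) hne.symm)
  have h1 := abs_lt.1 (hm i)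
  have h2 := abs_lt.1 (hm i')
  rw [← hf] at h2
  have h3 := hηA (f i)
  have h4 := hdη (f i)
  have h5 : (i : ℝ) + 1 ≤ i' := by exact_mod_cast Fin.lt_def.1 hlt
  have h6 : (i' : ℝ) ≤ i + 3 := by
    have := i'.isLt
    have h7 : (i' : ℕ) ≤ i + 3 := by omega
    exact_mod_cast h7
  have hpos : 0 ≤ α (f i) * η := mul_nonneg (hα _).le hη0.le
  have e1 : (i' - i : ℝ) * (α (f i) * η) ≤ 3 * (α (f i) * η) :=
    mul_le_mul_of_nonneg_right (by linarith) hpos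
  have e2 : 1 * (α (f i) * η) ≤ (i' - i : ℝ) * (α (f i) * η) :=
    mul_le_mul_of_nonneg_right (by linarith) hpos
  have hlow : (m i : ℝ) < m i' := by nlinarith
  have hup : (m i' : ℝ) < m i + 1 := by nlinarith
  have hlow' : m i < m i' := by exact_mod_cast hlow
  have hup' : m i' < m i + 1 := by exact_mod_cast hup
  omega

lemma separatedAtTop_eq (a b c : ℕ) (δ : ℝ) :
    separatedAtTop a b c δ
      = atTop ⊓ 𝓟 (separatedSet ![Real.log a, Real.log b, Real.log c] δ) := by
  unfold separatedAtTop
  congr 2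
  ext R
  simp [separatedSet, Fin.forall_fin_succ, forall_and]

/-! ### From lattice points back to products of powers. -/

/-- Logarithms of multiplicatively independent integers have an irrational ratio. -/
lemma int_mul_log_ne {a b : ℕ} (ha : 1 < a) (hb : 1 < b) (h : ∀ p q : ℕ, a ^ p = b ^ q → p = 0)
    {k m : ℤ} (hk : k ≠ 0) : (k : ℝ) * Real.log a ≠ m * Real.log b := by
  intro he
  have hla : 0 < Real.log a := Real.log_pos (by exact_mod_cast ha)
  have hlb : 0 < Real.log b := Real.log_pos (by exact_mod_cast hb)
  have h1 : (k.natAbs : ℝ) * Real.log a = m.natAbs * Real.log b := by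
    have := congrArg abs he
    rwa [abs_mul, abs_mul, abs_of_pos hla, abs_of_pos hlb, ← Int.cast_abs, ← Int.cast_abs,
      Int.abs_eq_natAbs, Int.abs_eq_natAbs, Int.cast_natCast, Int.cast_natCast] at this
  rw [← Real.log_pow, ← Real.log_pow] at h1
  have h2 := Real.log_injOn_pos (Set.mem_Ioi.2 (by positivity)) (Set.mem_Ioi.2 (by positivity)) h1
  have h3 : a ^ k.natAbs = b ^ m.natAbs := by exact_mod_cast h2
  exact hk (Int.natAbs_eq_zero.1 (h _ _ h3))

section count

variable {a b c : ℕ}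

lemma log_eq_linForm (ha : 1 < a) (hb : 1 < b) (hc : 1 < c) (n : Fin 3 → ℕ) :
    Real.log ((a ^ n 0 * b ^ n 1 * c ^ n 2 : ℕ) : ℝ)
      = linForm ![Real.log a, Real.log b, Real.log c] n := by
  have ha' : (a : ℝ) ≠ 0 := by positivity
  have hb' : (b : ℝ) ≠ 0 := by positivity
  have hc' : (c : ℝ) ≠ 0 := by positivity
  rw [linForm, Fin.sum_univ_three]
  push_cast
  rw [Real.log_mul (by positivity) (by positivity), Real.log_mul (by positivity) (by positivity),
    Real.log_pow, Real.log_pow, Real.log_pow]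

lemma mem_latticeBox_of_linForm_le {ι : Type*} [Fintype ι] [DecidableEq ι] {α : ι → ℝ}
    (hα : ∀ j, 0 < α j) {u : ℝ} {K : ℕ} (hK : ∀ j, u < K * α j) {n : ι → ℕ}
    (hn : linForm α n ≤ u) : n ∈ latticeBox ι K := by
  refine Fintype.mem_piFinset.2 fun j => Finset.mem_range.2 ?_
  have h1 : n j * α j ≤ linForm α n :=
    Finset.single_le_sum (f := fun j => n j * α j)
      (fun i _ => mul_nonneg (Nat.cast_nonneg _) (hα i).le) (Finset.mem_univ j)
  have h2 := lt_of_mul_lt_mul_right ((h1.trans hn).trans_lt (hK j)) (hα j).le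
  exact_mod_cast h2

/-- Taking logarithms identifies the lattice points with the triples. By injectivity at most one
triple has product exactly `x`, so the half weights on the boundary amount to half the
characteristic function. -/
lemma halfCount_three (ha : 1 < a) (hb : 1 < b) (hc : 1 < c)
    (hinj : Function.Injective (fun t : ℕ × ℕ × ℕ => a ^ t.1 * b ^ t.2.1 * c ^ t.2.2))
    {x : ℝ} (hx : 1 ≤ x) {K : ℕ}
    (hK : ∀ j, Real.log x < K * ![Real.log a, Real.log b, Real.log c] j) :
    halfCount ![Real.log a, Real.log b, Real.log c] (Real.log x) K
      = smoothCount a b c x - 1 / 2 * smoothChar a b c x := by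
  set α := ![Real.log a, Real.log b, Real.log c] with hαdef
  have hα : ∀ j, 0 < α j := by
    intro j
    fin_cases j
    · exact Real.log_pos (by exact_mod_cast ha)
    · exact Real.log_pos (by exact_mod_cast hb)
    · exact Real.log_pos (by exact_mod_cast hc)
  have hx0 : 0 < x := by linarith
  have hpos : ∀ n : Fin 3 → ℕ, (0 : ℝ) < ((a ^ n 0 * b ^ n 1 * c ^ n 2 : ℕ) : ℝ) := fun n => by
    positivity
  have hle : ∀ n : Fin 3 → ℕ, linForm α n ≤ Real.log x
      ↔ ((a ^ n 0 * b ^ n 1 * c ^ n 2 : ℕ) : ℝ) ≤ x := fun n => by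
    rw [hαdef, ← log_eq_linForm ha hb hc, Real.log_le_log_iff (hpos n) hx0]
  have heq : ∀ n : Fin 3 → ℕ, Real.log x = linForm α n
      ↔ x = ((a ^ n 0 * b ^ n 1 * c ^ n 2 : ℕ) : ℝ) := fun n => by
    rw [hαdef, ← log_eq_linForm ha hb hc]
    exact ⟨fun h => Real.log_injOn_pos hx0 (hpos n) h, fun h => by rw [← h]⟩
  unfold halfCount
  simp_rw [halfStep_sub]
  rw [Finset.sum_sub_distrib]
  congr 1
  · rw [← Finset.sum_filter, Finset.sum_const, nsmul_eq_mul, mul_one, smoothCount]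
    congr 1
    have hinj' : Function.Injective (fun n : Fin 3 → ℕ => (n 0, n 1, n 2)) := by
      intro n n' h
      simp only [Prod.mk.injEq] at h
      ext j
      fin_cases j
      exacts [h.1, h.2.1, h.2.2]
    rw [← Set.ncard_coe_finset, ← Set.ncard_image_of_injective _ hinj']
    congr 1
    ext ⟨p, q, l⟩
    simp only [Set.mem_image, Finset.coe_filter, Set.mem_ofPred_eq]
    constructor
    · rintro ⟨n, ⟨_, hn⟩, h⟩
      simp only [Prod.mk.injEq] at h
      obtain ⟨rfl, rfl, rfl⟩ := h
      exact (hle n).1 hn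
    · intro h
      have := (hle ![p, q, l]).2 h
      exact ⟨![p, q, l], ⟨mem_latticeBox_of_linForm_le hα hK this, this⟩, rfl⟩
  · unfold smoothChar
    by_cases hS : x ∈ smoothSet a b c
    · rw [Set.indicator_of_mem hS]
      obtain ⟨p, q, l, hpql⟩ := hS
      have h0 : Real.log x = linForm α ![p, q, l] := (heq ![p, q, l]).2 hpql
      rw [Finset.sum_eq_single ![p, q, l], if_pos h0, mul_one]
      · intro n _ hn
        rw [if_neg]
        intro h
        apply hn
        have h1 := (heq n).1 h
        rw [hpql, Nat.cast_inj] at h1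
        have h2 := @hinj (p, q, l) (n 0, n 1, n 2) h1
        simp only [Prod.mk.injEq] at h2
        ext j
        fin_cases j
        exacts [h2.1.symm, h2.2.1.symm, h2.2.2.symm]
      · exact fun h => absurd (mem_latticeBox_of_linForm_le hα hK h0.ge) h
    · rw [Set.indicator_of_notMem hS, mul_zero]
      refine Finset.sum_eq_zero fun n _ => if_neg fun h => hS ?_
      exact ⟨n 0, n 1, n 2, (heq n).1 h⟩

end count

/-! ### Assembly of the formula. -/

/-- The residue sums for three bases. -/
lemma tendsto_residueSum_three {a b c : ℕ}
    (hα : ∀ j, 0 < ![Real.log a, Real.log b, Real.log c] j)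
    (hirr : ∀ i j, i ≠ j → ∀ k m : ℤ, k ≠ 0 →
      (k : ℝ) * ![Real.log a, Real.log b, Real.log c] i
        ≠ m * ![Real.log a, Real.log b, Real.log c] j) {x : ℝ} (hx : 1 ≤ x) {K : ℕ}
    (hK : ∀ j, Real.log x < K * ![Real.log a, Real.log b, Real.log c] j) {δ : ℝ} (hδ : 0 < δ) :
    Tendsto (fun R => 1 / (4 * Real.pi) * (sinSum a x R + sinSum b x R + sinSum c x R
        - (cotCosSum a b x R + cotCosSum b a x R) - (cotCosSum b c x R + cotCosSum c b x R)
        - (cotCosSum c a x R + cotCosSum a c x R)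
        - (cotCotSinSum a b c x R + cotCotSinSum b a c x R + cotCotSinSum c a b x R)))
      (separatedAtTop a b c δ)
      (𝓝 (halfCount ![Real.log a, Real.log b, Real.log c] (Real.log x) K - cubicPart a b c x)) := by
  have ha : Real.log a ≠ 0 := (hα 0).ne'
  have hb : Real.log b ≠ 0 := (hα 1).ne'
  have hc : Real.log c ≠ 0 := (hα 2).ne'
  rw [separatedAtTop_eq]
  refine tendsto_of_cubicApprox hα hirr (Real.log_nonneg hx) hK (by decide)
    (by
      simp_rw [Fin.prod_univ_three]
      exact (cubicApprox_exp _).mul (((cubicApprox_inv_one_sub_exp (hα 0)).mul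
        (cubicApprox_inv_one_sub_exp (hα 1))).mul (cubicApprox_inv_one_sub_exp (hα 2))))
    ((cubicPoly_coeff_three _ _ _ _).trans ?_) (residueSum_three hα hirr x) hδ
  congr 1
  simp only [Matrix.cons_val_zero, Matrix.cons_val_one, Matrix.cons_val]
  unfold cubicPart
  field_simp
  ring

theorem smoothCount_formula {a b c : ℕ} (hab : a < b) (hbc : b < c)
    (hinj : Function.Injective (fun t : ℕ × ℕ × ℕ => a ^ t.1 * b ^ t.2.1 * c ^ t.2.2)) :
    (∃ δ : ℝ, 0 < δ ∧ (separatedAtTop a b c δ).NeBot) ∧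
      ∀ x : ℝ, 1 ≤ x → ∃ P₁ P₂ P₃ Q : ℝ,
        (∀ δ : ℝ, 0 < δ →
          Tendsto (fun R => cotCosSum a b x R + cotCosSum b a x R)
            (separatedAtTop a b c δ) (𝓝 P₁) ∧
          Tendsto (fun R => cotCosSum b c x R + cotCosSum c b x R)
            (separatedAtTop a b c δ) (𝓝 P₂) ∧
          Tendsto (fun R => cotCosSum c a x R + cotCosSum a c x R)
            (separatedAtTop a b c δ) (𝓝 P₃) ∧
          Tendsto (fun R => cotCotSinSum a b c x R + cotCotSinSum b a c x R
              + cotCotSinSum c a b x R)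
            (separatedAtTop a b c δ) (𝓝 Q)) ∧
        (smoothCount a b c x : ℝ) =
          cubicPart a b c x
            - 1 / 4 * bernoulliOneStar (Real.log x / Real.log a)
            - 1 / 4 * bernoulliOneStar (Real.log x / Real.log b)
            - 1 / 4 * bernoulliOneStar (Real.log x / Real.log c)
            - 1 / (4 * Real.pi) * P₁ - 1 / (4 * Real.pi) * P₂ - 1 / (4 * Real.pi) * P₃
            - 1 / (4 * Real.pi) * Q
            + 1 / 2 * smoothChar a b c x := by
  -- For `a = 0` or `a = 1` the first two powers of `a` coincide.
  have ha : 1 < a := by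
    by_contra! h
    have h1 : a ^ 1 = a ^ 2 := by interval_cases a <;> rfl
    have := @hinj (1, 0, 0) (2, 0, 0) (by simpa using h1)
    simp at this
  have hb : 1 < b := ha.trans hab
  have hc : 1 < c := hb.trans hbc
  set α := ![Real.log a, Real.log b, Real.log c] with hαdef
  have hα : ∀ j, 0 < α j := by
    intro j
    fin_cases j
    · exact Real.log_pos (by exact_mod_cast ha)
    · exact Real.log_pos (by exact_mod_cast hb)
    · exact Real.log_pos (by exact_mod_cast hc)
  -- Injectivity forces any two of the bases to be multiplicatively independent.
  have hirr : ∀ i j, i ≠ j → ∀ k m : ℤ, k ≠ 0 → (k : ℝ) * α i ≠ m * α j := by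
    have hab' : ∀ p q : ℕ, a ^ p = b ^ q → p = 0 ∧ q = 0 := fun p q h => by
      have := @hinj (p, 0, 0) (0, q, 0) (by simpa using h)
      simp only [Prod.mk.injEq] at this
      omega
    have hac' : ∀ p q : ℕ, a ^ p = c ^ q → p = 0 ∧ q = 0 := fun p q h => by
      have := @hinj (p, 0, 0) (0, 0, q) (by simpa using h)
      simp only [Prod.mk.injEq] at this
      omega
    have hbc' : ∀ p q : ℕ, b ^ p = c ^ q → p = 0 ∧ q = 0 := fun p q h => by
      have := @hinj (0, p, 0) (0, 0, q) (by simpa using h)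
      simp only [Prod.mk.injEq] at this
      omega
    intro i j hij k m hk
    fin_cases i <;> fin_cases j
    · exact absurd rfl hij
    · exact int_mul_log_ne ha hb (fun p q h => (hab' p q h).1) hk
    · exact int_mul_log_ne ha hc (fun p q h => (hac' p q h).1) hk
    · exact int_mul_log_ne hb ha (fun p q h => (hab' q p h.symm).2) hk
    · exact absurd rfl hij
    · exact int_mul_log_ne hb hc (fun p q h => (hbc' p q h).1) hk
    · exact int_mul_log_ne hc ha (fun p q h => (hac' q p h.symm).2) hk
    · exact int_mul_log_ne hc hb (fun p q h => (hbc' q p h.symm).2) hk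
    · exact absurd rfl hij
  have hpair : ∀ i j : Fin 3, i ≠ j → (∀ l, 0 < ![α i, α j] l) ∧
      ∀ l l', l ≠ l' → ∀ k m : ℤ, k ≠ 0 → (k : ℝ) * ![α i, α j] l ≠ m * ![α i, α j] l' := by
    intro i j hij
    refine ⟨fun l => ?_, fun l l' hl => ?_⟩
    · fin_cases l
      exacts [hα i, hα j]
    · fin_cases l <;> fin_cases l'
      · exact absurd rfl hl
      · exact hirr i j hij
      · exact hirr j i hij.symm
      · exact absurd rfl hl
  have hmono : ∀ (δ : ℝ) (i j : Fin 3),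
      separatedAtTop a b c δ ≤ atTop ⊓ 𝓟 (separatedSet ![α i, α j] δ) := fun δ i j => by
    rw [separatedAtTop_eq]
    refine inf_le_inf_left _ (principal_mono.2 fun R hR l m => ?_)
    fin_cases l
    exacts [hR i m, hR j m]
  have hmono' : ∀ (δ : ℝ) (i : Fin 3),
      separatedAtTop a b c δ ≤ atTop ⊓ 𝓟 (separatedSet ![α i] δ) := fun δ i => by
    rw [separatedAtTop_eq]
    refine inf_le_inf_left _ (principal_mono.2 fun R hR l m => ?_)
    fin_cases l
    exact hR i m
  refine ⟨?_, fun x hx => ?_⟩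
  · obtain ⟨δ, hδ, h⟩ := exists_separatedSet_neBot hα
    exact ⟨δ, hδ, by rwa [separatedAtTop_eq]⟩
  · obtain ⟨P₁, h₁⟩ := exists_tendsto_cotCosSum (a := a) (b := b)
      (hpair 0 1 (by decide)).1 (hpair 0 1 (by decide)).2 hx
    obtain ⟨P₂, h₂⟩ := exists_tendsto_cotCosSum (a := b) (b := c)
      (hpair 1 2 (by decide)).1 (hpair 1 2 (by decide)).2 hx
    obtain ⟨P₃, h₃⟩ := exists_tendsto_cotCosSum (a := c) (b := a)
      (hpair 2 0 (by decide)).1 (hpair 2 0 (by decide)).2 hx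
    obtain ⟨K, hK⟩ := exists_forall_lt_mul hα (Real.log x)
    have hpi := Real.pi_pos.ne'
    -- `Q` is found by solving the three-base limit for the cotangent-cotangent-sine sum, the other
    -- sums having known limits. Its value does not involve `δ`, and the formula follows by
    -- rearranging.
    refine ⟨P₁, P₂, P₃, -(Real.pi * bernoulliOneStar (Real.log x / Real.log a))
      + -(Real.pi * bernoulliOneStar (Real.log x / Real.log b))
      + -(Real.pi * bernoulliOneStar (Real.log x / Real.log c)) - P₁ - P₂ - P₃
      - 4 * Real.pi * (halfCount α (Real.log x) K - cubicPart a b c x), fun δ hδ => ?_, ?_⟩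
    · have t₁ := (h₁ δ hδ).mono_left (hmono δ 0 1)
      have t₂ := (h₂ δ hδ).mono_left (hmono δ 1 2)
      have t₃ := (h₃ δ hδ).mono_left (hmono δ 2 0)
      have sa := (tendsto_sinSum (hα 0) hx hδ).mono_left (hmono' δ 0)
      have sb := (tendsto_sinSum (hα 1) hx hδ).mono_left (hmono' δ 1)
      have sc := (tendsto_sinSum (hα 2) hx hδ).mono_left (hmono' δ 2)
      refine ⟨t₁, t₂, t₃, ?_⟩
      refine ((((((sa.add sb).add sc).sub t₁).sub t₂).sub t₃).sub
        ((tendsto_residueSum_three hα hirr hx hK hδ).const_mul (4 * Real.pi))).congr fun R => ?_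
      field_simp
      ring
    · rw [halfCount_three ha hb hc hinj hx hK]
      field_simp
      ring

/-! ### The triple 2, 3, 5 and the final statement. -/

lemma injective_two_three_five :
    Function.Injective (fun t : ℕ × ℕ × ℕ => 2 ^ t.1 * 3 ^ t.2.1 * 5 ^ t.2.2) := by
  have hf : ∀ p q l : ℕ, (2 ^ p * 3 ^ q * 5 ^ l).factorization
      = Finsupp.single 2 p + Finsupp.single 3 q + Finsupp.single 5 l := fun p q l => by
    rw [Nat.factorization_mul (by positivity) (by positivity),
      Nat.factorization_mul (by positivity) (by positivity), Nat.prime_two.factorization_pow,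
      Nat.prime_three.factorization_pow, Nat.prime_five.factorization_pow]
  rintro ⟨p, q, l⟩ ⟨p', q', l'⟩ h
  have h1 := congrArg Nat.factorization h
  simp only [hf] at h1
  have h2 := DFunLike.congr_fun h1 2
  have h3 := DFunLike.congr_fun h1 3
  have h5 := DFunLike.congr_fun h1 5
  simp at h2 h3 h5
  simp [h2, h3, h5]

theorem corollary15 :
    (∀ a b c : ℕ, a < b → b < c → Nat.gcd a (Nat.gcd b c) = 1 →
      Function.Injective (fun t : ℕ × ℕ × ℕ => a ^ t.1 * b ^ t.2.1 * c ^ t.2.2) →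
      (∃ δ : ℝ, 0 < δ ∧ (separatedAtTop a b c δ).NeBot) ∧
      ∀ x : ℝ, 1 ≤ x → ∃ P₁ P₂ P₃ Q : ℝ,
        (∀ δ : ℝ, 0 < δ →
          Tendsto (fun R => cotCosSum a b x R + cotCosSum b a x R)
            (separatedAtTop a b c δ) (𝓝 P₁) ∧
          Tendsto (fun R => cotCosSum b c x R + cotCosSum c b x R)
            (separatedAtTop a b c δ) (𝓝 P₂) ∧
          Tendsto (fun R => cotCosSum c a x R + cotCosSum a c x R)
            (separatedAtTop a b c δ) (𝓝 P₃) ∧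
          Tendsto (fun R => cotCotSinSum a b c x R + cotCotSinSum b a c x R
              + cotCotSinSum c a b x R)
            (separatedAtTop a b c δ) (𝓝 Q)) ∧
        (smoothCount a b c x : ℝ) =
          cubicPart a b c x
            - 1 / 4 * bernoulliOneStar (Real.log x / Real.log a)
            - 1 / 4 * bernoulliOneStar (Real.log x / Real.log b)
            - 1 / 4 * bernoulliOneStar (Real.log x / Real.log c)
            - 1 / (4 * Real.pi) * P₁ - 1 / (4 * Real.pi) * P₂ - 1 / (4 * Real.pi) * P₃
            - 1 / (4 * Real.pi) * Q
            + 1 / 2 * smoothChar a b c x) ∧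
    ((∃ δ : ℝ, 0 < δ ∧ (separatedAtTop 2 3 5 δ).NeBot) ∧
     ∀ x : ℝ, 1 ≤ x → ∃ P₁ P₂ P₃ Q : ℝ,
       (∀ δ : ℝ, 0 < δ →
         Tendsto (fun R => cotCosSum 2 3 x R + cotCosSum 3 2 x R)
           (separatedAtTop 2 3 5 δ) (𝓝 P₁) ∧
         Tendsto (fun R => cotCosSum 3 5 x R + cotCosSum 5 3 x R)
           (separatedAtTop 2 3 5 δ) (𝓝 P₂) ∧
         Tendsto (fun R => cotCosSum 5 2 x R + cotCosSum 2 5 x R)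
           (separatedAtTop 2 3 5 δ) (𝓝 P₃) ∧
         Tendsto (fun R => cotCotSinSum 2 3 5 x R + cotCotSinSum 3 2 5 x R
             + cotCotSinSum 5 2 3 x R)
           (separatedAtTop 2 3 5 δ) (𝓝 Q)) ∧
       (smoothCount 2 3 5 x : ℝ) =
         cubicPart 2 3 5 x
           - 1 / 4 * bernoulliOneStar (Real.log x / Real.log 2)
           - 1 / 4 * bernoulliOneStar (Real.log x / Real.log 3)
           - 1 / 4 * bernoulliOneStar (Real.log x / Real.log 5)
           - 1 / (4 * Real.pi) * P₁ - 1 / (4 * Real.pi) * P₂ - 1 / (4 * Real.pi) * P₃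
           - 1 / (4 * Real.pi) * Q
           + 1 / 2 * smoothChar 2 3 5 x) := by
  refine ⟨fun a b c hab hbc _ hinj => smoothCount_formula hab hbc hinj, ?_⟩
  simpa only [Nat.cast_ofNat] using
    smoothCount_formula (a := 2) (b := 3) (c := 5) (by norm_num) (by norm_num)
      injective_two_three_five
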